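/- **Setting.** Let $\Sigma$ be a finite alphabet and $\mathbb Q$ a countable set of properties. The set $\mathcal T$ of unordered data trees is the least set containing all finite multisets $\{\!|d_1:t_1,\dots,d_n:t_n|\!\}$ of pairs with $n\ge 0$, $d_i\in\Sigma^*$, $t_i\in\mathcal T$. Fix a set $\mathrm{Pat}$ of regular expressions over $\Sigma$ (built from words by concatenation, $+$ and ${}^*$). *Filters* are given by $\varphi::=\pi\mid q\mid\varphi\wedge\varphi\mid\neg\varphi$ with $\pi\in\mathrm{Pat}$, $q\in\mathbb Q$; for $d\in\Sigma^*$ and $Q\subseteq\mathbb Q$, $(d,Q)\models\pi$ iff $d$ matches $\pi$, and $(d,Q)\models q$ iff $q\in Q$. A filter is *singleton-satisfiable* if it is satisfied by some $(d,Q)$ with $|Q|\le 1$. A *horizontal automaton* $H=(P,R)$ has a finite set $P$ of horizontal states and a finite set $R\subseteq P\times\text{Filters}\times P$ of transitions. It rewrites $(p,M+\{\!|d:Q|\!\})\to_H(p',M)$ whenever $(p,\varphi,p')\in R$ and $(d,Q)\models\varphi$ for some $\varphi$, where $M$ is a finite multiset over $\Sigma^*\times 2^{\mathbb Q}$; write $M\models(p,p')$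 if $(p,M)\to_H^*(p',\emptyset)$. $H$ is *confluent* if the relation obtained from $\to_H$ by adding $(p,M)\to\bot$ for all $(p,M)$ with $M\neq\emptyset$ and no $\to_H$-successor is confluent. An *AUTC* $A$ consists of a confluent horizontal automaton $H=(P,R)$, an initial horizontal state $p_0\in P$, a finite set $\mathcal Q\subseteq\mathbb Q$ of states, a set $\mathcal Q_f\subseteq \mathcal Q$ of final states, and a finite set of rules $(p_0,p)\to q$ with $p\in P$, $q\in \mathcal Q$, such that the descriptors $(p_0,p)$ of the rules have support in $\mathcal Q$ (whether $\{\!|d_1:Q_1,\dots,d_n:Q_n|\!\}\models(p_0,p)$ depends only on the sets $Q_i\cap\mathcal Q$). A tree is evaluated by $[\![\{\!|d_1:t_1,\dots,d_n:t_n|\!\}]\!]_A=\{q\mid (p_0,p)\to q \text{ is a rule for some } p \text{ with } \{\!|d_1:[\![t_1]\!]_A,\dots,d_n:[\![t_n]\!]_A|\!\}\models(p_0,p)\}$, and $A$ is required to be vertically deterministic: $|[\![t]\!]_A|\le 1$ for all $t\in\mathcal T$. Its language is $L(A)=\{t\in\mathcal T\mid[\![t]\!]_A\cap\mathcal Q_f\neq\emptyset\}$.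 **Proposition (AUTC Emptiness).** If singleton-satisfiability of filters is decidable in polynomial time, then it is decidable in polynomial time, given an AUTC $A$, whether $L(A)=\emptyset$. (Time is measured in the length of the encoding of the filter, respectively of the AUTC, where properties and horizontal states are written by any fixed injective coding of names.) -/

import Mathlib

namespace UnorderedTrees

/-! ## A programming language over binary trees, with a running time

Inputs and outputs are binary trees (S-expressions). The language is the variable-free form of
the usual WHILE language over such trees. Every elementary operation is charged the size of the
tree it is applied to, so that a run costs at least the size of its input and of its output, and
the problems decidable in polynomial time are those of the class P. -/

/-- Binary trees, the data that programs work on. -/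
inductive Data : Type
  | nil : Data
  | cons : Data → Data → Data

/-- The number of nodes, leaves included. -/
def Data.size : Data → ℕ
  | .nil => 1
  | .cons a b => a.size + b.size + 1

/-- First component (of `nil`: `nil`). -/
def Data.hd : Data → Data
  | .nil => .nil
  | .cons a _ => a

/-- Second component (of `nil`: `nil`). -/
def Data.tl : Data → Data
  | .nil => .nil
  | .cons _ b => b

/-- The list `[a, b, …]` as `cons a (cons b …)`. -/
def Data.ofList : List Data → Data
  | [] => .nil
  | a :: l => .cons a (Data.ofList l)

/-- Programs; each acts on one tree and returns one tree. -/
inductive Prog : Type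
  | id : Prog
  | nil : Prog
  | hd : Prog
  | tl : Prog
  /-- `pair f g` maps `x` to `cons (f x) (g x)` -/
  | pair : Prog → Prog → Prog
  /-- `seq f g` runs `f` and then `g` on its result -/
  | seq : Prog → Prog → Prog
  /-- `ite b f g` runs `f` if `b x ≠ nil`, and `g` otherwise -/
  | ite : Prog → Prog → Prog → Prog
  /-- `loop b f`: while `b x ≠ nil`, replace `x` by `f x` -/
  | loop : Prog → Prog → Prog

/-- `Run c x y t`: the program `c`, started on `x`, stops with result `y` after `t` steps. -/
inductive Run : Prog → Data → Data → ℕ → Prop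
  | id (x : Data) : Run .id x x x.size
  | nil (x : Data) : Run .nil x .nil x.size
  | hd (x : Data) : Run .hd x x.hd x.size
  | tl (x : Data) : Run .tl x x.tl x.size
  | pair {f g : Prog} {x y z : Data} {s t : ℕ} :
      Run f x y s → Run g x z t → Run (.pair f g) x (.cons y z) (s + t + 1)
  | seq {f g : Prog} {x y z : Data} {s t : ℕ} :
      Run f x y s → Run g y z t → Run (.seq f g) x z (s + t + 1)
  | ite_true {b f g : Prog} {x v y : Data} {s t : ℕ} :
      Run b x v s → v ≠ .nil → Run f x y t → Run (.ite b f g) x y (s + t + 1)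
  | ite_false {b f g : Prog} {x y : Data} {s t : ℕ} :
      Run b x .nil s → Run g x y t → Run (.ite b f g) x y (s + t + 1)
  | loop_stop {b f : Prog} {x : Data} {s : ℕ} :
      Run b x .nil s → Run (.loop b f) x x (s + 1)
  | loop_step {b f : Prog} {x v y z : Data} {s t u : ℕ} :
      Run b x v s → v ≠ .nil → Run f x y t → Run (.loop b f) y z u →
        Run (.loop b f) x z (s + t + u + 1)

/-- Programs are deterministic: result and running time are determined by the input. -/
theorem Run.det {c : Prog} {x y : Data} {t : ℕ} (h : Run c x y t) :
    ∀ {z : Data} {u : ℕ}, Run c x z u → y = z ∧ t = u := by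
  induction h with
  | id x => intro z u h; cases h; exact ⟨rfl, rfl⟩
  | nil x => intro z u h; cases h; exact ⟨rfl, rfl⟩
  | hd x => intro z u h; cases h; exact ⟨rfl, rfl⟩
  | tl x => intro z u h; cases h; exact ⟨rfl, rfl⟩
  | pair _ _ ih1 ih2 =>
    intro z u h
    cases h with
    | pair h1 h2 =>
      obtain ⟨rfl, rfl⟩ := ih1 h1
      obtain ⟨rfl, rfl⟩ := ih2 h2
      exact ⟨rfl, rfl⟩
  | seq _ _ ih1 ih2 =>
    intro z u h
    cases h with
    | seq h1 h2 =>
      obtain ⟨rfl, rfl⟩ := ih1 h1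
      obtain ⟨rfl, rfl⟩ := ih2 h2
      exact ⟨rfl, rfl⟩
  | ite_true _ hv _ ih1 ih2 =>
    intro z u h
    cases h with
    | ite_true h1 _ h2 =>
      obtain ⟨rfl, rfl⟩ := ih1 h1
      obtain ⟨rfl, rfl⟩ := ih2 h2
      exact ⟨rfl, rfl⟩
    | ite_false h1 _ => exact absurd (ih1 h1).1 hv
  | ite_false _ _ ih1 ih2 =>
    intro z u h
    cases h with
    | ite_true h1 hv _ => exact absurd (ih1 h1).1.symm hv
    | ite_false h1 h2 =>
      obtain ⟨-, rfl⟩ := ih1 h1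
      obtain ⟨rfl, rfl⟩ := ih2 h2
      exact ⟨rfl, rfl⟩
  | loop_stop _ ih =>
    intro z u h
    cases h with
    | loop_stop h1 => obtain ⟨-, rfl⟩ := ih h1; exact ⟨rfl, rfl⟩
    | loop_step h1 hv _ _ => exact absurd (ih h1).1.symm hv
  | loop_step _ hv _ _ ih1 ih2 ih3 =>
    intro z u h
    cases h with
    | loop_stop h1 => exact absurd (ih1 h1).1 hv
    | loop_step h1 _ h2 h3 =>
      obtain ⟨rfl, rfl⟩ := ih1 h1
      obtain ⟨rfl, rfl⟩ := ih2 h2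
      obtain ⟨rfl, rfl⟩ := ih3 h3
      exact ⟨rfl, rfl⟩

/-- The problem "does the instance `x` have the property `L`?", where instances are given by
their codes, is decidable in polynomial time: one program answers (`nil` for no, anything else
for yes) on every instance, within a number of steps polynomial in the size of the code. What
the program does on trees that are not codes of instances is irrelevant. -/
def PolyTimeDecidable {I : Type} (code : I → Data) (L : I → Prop) : Prop :=
  ∃ (c : Prog) (p : Polynomial ℕ), ∀ x : I, ∃ (y : Data) (t : ℕ),
    Run c (code x) y t ∧ t ≤ p.eval (code x).size ∧ (y ≠ .nil ↔ L x)

/-- A coding of the elements of a (necessarily countable) set by pairwise different trees. -/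
structure Coding (X : Type) where
  code : X → Data
  injective : Function.Injective code

/-- The code of a list. -/
def Coding.list {X : Type} (code : X → Data) (l : List X) : Data :=
  Data.ofList (l.map code)

/-! ## Unordered data trees

A data value is a word in `List α`. The trees are the least set containing all finite multisets
of pairs (data value, tree). They are built as finite sequences of such pairs (`PreTree`), up
to the order of the pairs at every node; `Tree.node` and `Tree.children` are the resulting
mutually inverse maps between trees and multisets of pairs. -/

/-- Trees with ordered edges: `nil` has no edges, and `cons d t r` is `r` with an additional
first edge labelled `d` to `t`. -/
inductive PreTree (α : Type) : Type
  | nil : PreTree α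
  | cons : List α → PreTree α → PreTree α → PreTree α

/-- Equality up to the order of the edges, at all nodes. -/
inductive PreTree.Equiv {α : Type} : PreTree α → PreTree α → Prop
  | refl (t : PreTree α) : PreTree.Equiv t t
  | symm {s t : PreTree α} : PreTree.Equiv s t → PreTree.Equiv t s
  | trans {s t u : PreTree α} : PreTree.Equiv s t → PreTree.Equiv t u → PreTree.Equiv s u
  | cons (d : List α) {s t r q : PreTree α} :
      PreTree.Equiv s t → PreTree.Equiv r q → PreTree.Equiv (.cons d s r) (.cons d t q)
  | swap (d e : List α) (s t r : PreTree α) :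
      PreTree.Equiv (.cons d s (.cons e t r)) (.cons e t (.cons d s r))

instance PreTree.setoid (α : Type) : Setoid (PreTree α) where
  r := PreTree.Equiv
  iseqv := ⟨PreTree.Equiv.refl, PreTree.Equiv.symm, PreTree.Equiv.trans⟩

/-- Unordered, unranked, edge-labelled data trees over the alphabet `α`. -/
def Tree (α : Type) : Type := Quotient (PreTree.setoid α)

namespace Tree

variable {α : Type}

/-- The tree without edges. -/
def empty : Tree α := Quotient.mk _ PreTree.nil

/-- The tree `r` with an additional edge labelled `d` to `t`. -/
def add (x : List α × Tree α) (r : Tree α) : Tree α :=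
  Quotient.map₂ (PreTree.cons x.1) (fun _ _ h _ _ k => PreTree.Equiv.cons x.1 h k) x.2 r

theorem add_comm (x y : List α × Tree α) (r : Tree α) : add x (add y r) = add y (add x r) := by
  obtain ⟨d, s⟩ := x
  obtain ⟨e, t⟩ := y
  induction s using Quotient.ind
  induction t using Quotient.ind
  induction r using Quotient.ind
  exact Quotient.sound (PreTree.Equiv.swap _ _ _ _ _)

/-- The tree `{d₁ : t₁, …, dₙ : tₙ}`. -/
def node (M : Multiset (List α × Tree α)) : Tree α :=
  haveI : LeftCommutative (add (α := α)) := ⟨add_comm⟩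
  M.foldr add empty

end Tree

/-- The multiset of the pairs at the root of an ordered tree. -/
def PreTree.children {α : Type} : PreTree α → Multiset (List α × Tree α)
  | .nil => 0
  | .cons d t r => (d, (Quotient.mk _ t : Tree α)) ::ₘ r.children

theorem PreTree.children_eq {α : Type} {s t : PreTree α} (h : PreTree.Equiv s t) :
    s.children = t.children := by
  induction h with
  | refl => rfl
  | symm _ ih => exact ih.symm
  | trans _ _ ih1 ih2 => exact ih1.trans ih2
  | cons d h _ _ ih =>
    simp only [PreTree.children, ih]
    rw [Quotient.sound h]
  | swap d e s t r => exact Multiset.cons_swap _ _ _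

namespace Tree

variable {α : Type}

/-- The multiset of the pairs at the root of a tree. -/
def children (t : Tree α) : Multiset (List α × Tree α) :=
  Quotient.lift PreTree.children (fun _ _ h => PreTree.children_eq h) t

theorem children_add (x : List α × Tree α) (r : Tree α) :
    (add x r).children = x ::ₘ r.children := by
  obtain ⟨d, s⟩ := x
  induction s using Quotient.ind
  induction r using Quotient.ind
  rfl

theorem node_cons (x : List α × Tree α) (M : Multiset (List α × Tree α)) :
    node (x ::ₘ M) = add x (node M) := by
  have : LeftCommutative (add (α := α)) := ⟨add_comm⟩
  exact Multiset.foldr_cons _ _ _ _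

theorem children_node (M : Multiset (List α × Tree α)) : (node M).children = M := by
  induction M using Multiset.induction_on with
  | empty => rfl
  | cons x M ih => rw [node_cons, children_add, ih]

theorem node_children (t : Tree α) : node t.children = t := by
  induction t using Quotient.ind with
  | _ a =>
    induction a with
    | nil => rfl
    | cons d s r _ ih =>
      have h : children (Quotient.mk _ (PreTree.cons d s r) : Tree α)
          = (d, (Quotient.mk _ s : Tree α)) ::ₘ children (Quotient.mk _ r : Tree α) := rfl
      rw [h]
      refine (node_cons _ _).trans ?_
      rw [ih]
      rfl

end Tree

/-! ## Descriptor classes and automata for unordered trees -/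

/-- A class of descriptors for models in `X`. (The size of a descriptor is that of its code.) -/
structure DescriptorClass (X : Type) where
  Desc : Type
  Sat : X → Desc → Prop

/-- The subclass with the descriptors in `S`. -/
def DescriptorClass.restrict {X : Type} (D : DescriptorClass X) (S : Set D.Desc) :
    DescriptorClass X where
  Desc := S
  Sat x h := D.Sat x h.1

/-- Horizontal descriptors describe multisets of pairs of a data value and a set of properties. -/
abbrev HorizontalClass (α QQ : Type) : Type 1 :=
  DescriptorClass (Multiset (List α × Set QQ))

/-- Satisfaction of `h` by `{d₁ : Q₁, …, dₙ : Qₙ}` depends on the sets `Qᵢ ∩ Q` only. -/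
def HorizontalClass.DependsOnlyOn {α QQ : Type} (D : HorizontalClass α QQ) (h : D.Desc)
    (Q : Set QQ) : Prop :=
  ∀ l : List (List α × Set QQ × Set QQ), (∀ x ∈ l, x.2.1 ∩ Q = x.2.2 ∩ Q) →
    (D.Sat (l.map fun x => (x.1, x.2.1) : List (List α × Set QQ)) h ↔
      D.Sat (l.map fun x => (x.1, x.2.2) : List (List α × Set QQ)) h)

/-- The support of `h`: the least set of properties that `h` depends on. -/
def HorizontalClass.support {α QQ : Type} (D : HorizontalClass α QQ) (h : D.Desc) : Set QQ :=
  ⋂₀ {Q | HorizontalClass.DependsOnlyOn D h Q}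

/-- Alternating bottom-up automata for unordered unranked data trees, with horizontal
descriptors in `D`. Finite sets are given by lists of their elements. -/
structure AUT {α QQ : Type} (D : HorizontalClass α QQ) where
  states : List QQ
  final : List QQ
  final_subset : ∀ q ∈ final, q ∈ states
  rules : List (D.Desc × QQ)
  rules_target : ∀ r ∈ rules, r.2 ∈ states
  rules_support : ∀ r ∈ rules, HorizontalClass.support D r.1 ⊆ {q | q ∈ states}

namespace AUT

variable {α QQ : Type} {D : HorizontalClass α QQ}

/-- The states that the rules assign to a node whose annotated edges form the multiset `M`. -/
def step (A : AUT D) (M : Multiset (List α × Set QQ)) : Set QQ :=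
  {q | ∃ h : D.Desc, (h, q) ∈ A.rules ∧ D.Sat M h}

/-- The edges at the root, annotated with the values of the subtrees. -/
def annotate (A : AUT D) : PreTree α → Multiset (List α × Set QQ)
  | .nil => 0
  | .cons d t r => (d, A.step (A.annotate t)) ::ₘ A.annotate r

theorem annotate_eq (A : AUT D) {s t : PreTree α} (h : PreTree.Equiv s t) :
    A.annotate s = A.annotate t := by
  induction h with
  | refl => rfl
  | symm _ ih => exact ih.symm
  | trans _ _ ih1 ih2 => exact ih1.trans ih2
  | cons d _ _ ih1 ih2 => simp only [annotate, ih1, ih2]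
  | swap d e s t r => exact Multiset.cons_swap _ _ _

/-- The set of states that the automaton assigns to a tree; `eval_eq` is the recursion. -/
def eval (A : AUT D) (t : Tree α) : Set QQ :=
  Quotient.lift (fun s => A.step (A.annotate s))
    (fun _ _ h => congrArg A.step (A.annotate_eq h)) t

theorem eval_eq (A : AUT D) (t : Tree α) :
    A.eval t = A.step (t.children.map fun x => (x.1, A.eval x.2)) := by
  induction t using Quotient.ind with
  | _ a =>
    have h : A.annotate a = a.children.map fun x => (x.1, A.eval x.2) := by
      induction a with
      | nil => rfl
      | cons d s r _ ih =>
        simp only [annotate, PreTree.children, Multiset.map_cons, ← ih]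
        rfl
    exact congrArg A.step h

/-- The language of the automaton. -/
def language (A : AUT D) : Set (Tree α) :=
  {t | ∃ q ∈ A.eval t, q ∈ A.final}

/-- Every tree is evaluated to at most one state. -/
def VerticallyDeterministic (A : AUT D) : Prop :=
  ∀ t : Tree α, (A.eval t).Subsingleton

/-- The code of an automaton, given codes of properties and descriptors. -/
def code (codeQ : QQ → Data) (codeD : D.Desc → Data) (A : AUT D) : Data :=
  .cons (Coding.list codeQ A.states) (.cons (Coding.list codeQ A.final)
    (Coding.list (fun r => .cons (codeD r.1) (codeQ r.2)) A.rules))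

end AUT

/-! ## Patterns and filters -/

/-- Regular expressions, built from words. -/
inductive Pattern (α : Type) : Type
  | word : List α → Pattern α
  | cat : Pattern α → Pattern α → Pattern α
  | alt : Pattern α → Pattern α → Pattern α
  | star : Pattern α → Pattern α

/-- The set of words that match a pattern. -/
def Pattern.lang {α : Type} : Pattern α → Language α
  | .word d => {d}
  | .cat a b => a.lang * b.lang
  | .alt a b => a.lang + b.lang
  | .star a => KStar.kstar a.lang

/-- The code of a pattern. -/
def Pattern.code {α : Type} (c : α → Data) : Pattern α → Data
  | .word d => .cons .nil (Coding.list c d)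
  | .cat a b => .cons (.cons .nil .nil) (.cons (a.code c) (b.code c))
  | .alt a b => .cons (.cons .nil (.cons .nil .nil)) (.cons (a.code c) (b.code c))
  | .star a => .cons (.cons (.cons .nil .nil) .nil) (a.code c)

/-- Filters: Boolean combinations of patterns in `Pat` and of properties. -/
inductive EdgeFilter (α QQ : Type) (Pat : Set (Pattern α)) : Type
  | pat : Pat → EdgeFilter α QQ Pat
  | prop : QQ → EdgeFilter α QQ Pat
  | and : EdgeFilter α QQ Pat → EdgeFilter α QQ Pat → EdgeFilter α QQ Pat
  | not : EdgeFilter α QQ Pat → EdgeFilter α QQ Pat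

namespace EdgeFilter

variable {α QQ : Type} {Pat : Set (Pattern α)}

/-- Satisfaction of a filter by a pair of a data value and a set of properties. -/
def Sat (x : List α × Set QQ) : EdgeFilter α QQ Pat → Prop
  | .pat a => x.1 ∈ a.1.lang
  | .prop q => q ∈ x.2
  | .and f g => f.Sat x ∧ g.Sat x
  | .not f => ¬ f.Sat x

/-- Singleton-satisfiability: some pair `(d, Q)`, with `Q` empty or a singleton, satisfies `f`. -/
def SingletonSatisfiable (f : EdgeFilter α QQ Pat) : Prop :=
  ∃ (d : List α) (Q : Set QQ), Q.Subsingleton ∧ f.Sat (d, Q)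

/-- The code of a filter. -/
def code (codeA : α → Data) (codeQ : QQ → Data) : EdgeFilter α QQ Pat → Data
  | .pat a => .cons .nil (a.1.code codeA)
  | .prop q => .cons (.cons .nil .nil) (codeQ q)
  | .and f g => .cons (.cons .nil (.cons .nil .nil))
      (.cons (f.code codeA codeQ) (g.code codeA codeQ))
  | .not f => .cons (.cons (.cons .nil .nil) .nil) (f.code codeA codeQ)

end EdgeFilter

/-! ## Horizontal automata and AUTCs -/

/-- Horizontal automata, with states taken from `PP`; the finite sets of states and of transitions
are given by lists of their elements. -/
structure HorizontalAutomaton (α QQ PP : Type) (Pat : Set (Pattern α)) where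
  states : List PP
  rules : List (PP × EdgeFilter α QQ Pat × PP)
  rules_mem : ∀ r ∈ rules, r.1 ∈ states ∧ r.2.2 ∈ states

namespace HorizontalAutomaton

variable {α QQ PP : Type} {Pat : Set (Pattern α)}

/-- The horizontal rewriting relation. -/
def Rew (H : HorizontalAutomaton α QQ PP Pat) (a b : PP × Multiset (List α × Set QQ)) : Prop :=
  ∃ (x : List α × Set QQ) (f : EdgeFilter α QQ Pat),
    a.2 = x ::ₘ b.2 ∧ (a.1, f, b.1) ∈ H.rules ∧ f.Sat x

/-- The descriptor class of a horizontal automaton: pairs of an initial and a final state. -/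
def descriptorClass (H : HorizontalAutomaton α QQ PP Pat) : HorizontalClass α QQ where
  Desc := {h : PP × PP // h.1 ∈ H.states ∧ h.2 ∈ H.states}
  Sat M h := Relation.ReflTransGen H.Rew (h.1.1, M) (h.1.2, 0)

/-- The failure-extended rewriting relation; `none` is the failure `⊥`. -/
inductive FailRew (H : HorizontalAutomaton α QQ PP Pat) :
    Option (PP × Multiset (List α × Set QQ)) → Option (PP × Multiset (List α × Set QQ)) → Prop
  | rew {a b : PP × Multiset (List α × Set QQ)} : H.Rew a b → FailRew H (some a) (some b)
  | fail {a : PP × Multiset (List α × Set QQ)} :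
      a.2 ≠ 0 → (¬ ∃ b, H.Rew a b) → FailRew H (some a) none

/-- Confluence of the failure-extended rewriting relation. (Elements of `PP` that are not states
have no transitions, so configurations with such elements do not matter.) -/
def Confluent (H : HorizontalAutomaton α QQ PP Pat) : Prop :=
  ∀ a b c, Relation.ReflTransGen H.FailRew a b → Relation.ReflTransGen H.FailRew a c →
    ∃ d, Relation.ReflTransGen H.FailRew b d ∧ Relation.ReflTransGen H.FailRew c d

/-- The subclass of the descriptors with initial state `p₀`. -/
def confClass (H : HorizontalAutomaton α QQ PP Pat) (p₀ : PP) : HorizontalClass α QQ :=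
  H.descriptorClass.restrict {h | h.1.1 = p₀}

/-- The code of a descriptor. -/
def codeDesc (H : HorizontalAutomaton α QQ PP Pat) (p₀ : PP) (codeP : PP → Data)
    (h : (H.confClass p₀).Desc) : Data :=
  .cons (codeP h.1.1.1) (codeP h.1.1.2)

/-- The code of a horizontal automaton. -/
def code (codeA : α → Data) (codeQ : QQ → Data) (codeP : PP → Data)
    (H : HorizontalAutomaton α QQ PP Pat) : Data :=
  .cons (Coding.list codeP H.states)
    (Coding.list (fun r => .cons (codeP r.1) (.cons (r.2.1.code codeA codeQ) (codeP r.2.2)))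
      H.rules)

end HorizontalAutomaton

/-- AUTCs: vertically deterministic automata over the descriptors, with a fixed initial state, of
a confluent horizontal automaton. -/
structure AUTC (α QQ PP : Type) (Pat : Set (Pattern α)) where
  horizontal : HorizontalAutomaton α QQ PP Pat
  initial : PP
  initial_mem : initial ∈ horizontal.states
  confluent : horizontal.Confluent
  aut : AUT (horizontal.confClass initial)
  deterministic : aut.VerticallyDeterministic

namespace AUTC

variable {α QQ PP : Type} {Pat : Set (Pattern α)}

/-- The language of an AUTC. -/
def language (A : AUTC α QQ PP Pat) : Set (Tree α) := A.aut.language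

/-- The code of an AUTC. -/
def code (codeA : α → Data) (codeQ : QQ → Data) (codeP : PP → Data)
    (A : AUTC α QQ PP Pat) : Data :=
  .cons (A.horizontal.code codeA codeQ codeP)
    (.cons (codeP A.initial)
      (A.aut.code codeQ (A.horizontal.codeDesc A.initial codeP)))

end AUTC

end UnorderedTrees

namespace UnorderedTrees

/-! ## Polynomial bounds -/

-- By vertical determinism the value of a tree is either empty or a single state, so there are only
-- `|states| + 1` candidate values. Emptiness is decided by saturating two kinds of facts at once: a
-- horizontal state `p` is reachable from the initial state by reading edges that carry realizable
-- values, and a value `v` is realized by some tree. These facts obey Horn clauses. A transition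
-- whose filter is compatible with a realized value leads from one reachable state to another; a
-- rule with a reachable end state realizes its target. The empty value arises in two ways: a run
-- ends in a state without a rule (`lackClauses`), or it is stuck on an edge that no transition
-- accepts (`failClauses`). The side conditions ask whether finitely many filters hold jointly at
-- some `(d, Q)` with `|Q| ≤ 1`; this is singleton-satisfiability of their conjunction, and
-- polynomially many such queries suffice.
--
-- Soundness (`valid_of_derivable`) builds trees from derivations. Confluence enters exactly at the
-- two clauses for the empty value: one completed run determines the end state of all completed
-- runs, and one stuck run excludes completed ones. The support condition enters in `mem_eval_tree`:
-- a witness `Q` may contain a property that is not a state, and must be exchanged for the actual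
-- value of a tree. Completeness (`derivable_eval`) is an induction on trees that follows one run at
-- each node. Together they give `language_eq_empty_iff`.
--
-- For the running time, `PolyTime` is closed under composition, branching, folds over lists and
-- forward chaining, so `polyTime_finalDerivable` follows the shape of the definitions.

theorem eval_mono_nat (p : Polynomial ℕ) : Monotone fun n => p.eval n := by
  intro m n h
  simp only [Polynomial.eval_eq_sum_range]
  gcongr

/-- `g` is bounded by a polynomial in `f`. -/
def PolyBounded {I : Type} (f g : I → ℕ) : Prop :=
  ∃ p : Polynomial ℕ, ∀ i, g i ≤ p.eval (f i)

namespace PolyBounded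

variable {I J : Type} {f g h : I → ℕ}

theorem refl (f : I → ℕ) : PolyBounded f f := ⟨Polynomial.X, fun i => by simp⟩

theorem const (f : I → ℕ) (n : ℕ) : PolyBounded f fun _ => n := ⟨Polynomial.C n, fun i => by simp⟩

theorem add (hg : PolyBounded f g) (hh : PolyBounded f h) :
    PolyBounded f fun i => g i + h i := by
  obtain ⟨p, hp⟩ := hg
  obtain ⟨q, hq⟩ := hh
  exact ⟨p + q, fun i => by rw [Polynomial.eval_add]; exact add_le_add (hp i) (hq i)⟩

theorem mul (hg : PolyBounded f g) (hh : PolyBounded f h) :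
    PolyBounded f fun i => g i * h i := by
  obtain ⟨p, hp⟩ := hg
  obtain ⟨q, hq⟩ := hh
  exact ⟨p * q, fun i => by rw [Polynomial.eval_mul]; exact Nat.mul_le_mul (hp i) (hq i)⟩

theorem mono (hg : PolyBounded f g) (hh : ∀ i, h i ≤ g i) : PolyBounded f h := by
  obtain ⟨p, hp⟩ := hg
  exact ⟨p, fun i => (hh i).trans (hp i)⟩

theorem trans (hg : PolyBounded f g) (hh : PolyBounded g h) : PolyBounded f h := by
  obtain ⟨p, hp⟩ := hg
  obtain ⟨q, hq⟩ := hh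
  exact ⟨q.comp p, fun i => by
    rw [Polynomial.eval_comp]; exact (hq i).trans (eval_mono_nat q (hp i))⟩

theorem reindex (hg : PolyBounded f g) (k : J → I) :
    PolyBounded (fun j => f (k j)) fun j => g (k j) := by
  obtain ⟨p, hp⟩ := hg
  exact ⟨p, fun j => hp (k j)⟩

theorem eval (hg : PolyBounded f g) (p : Polynomial ℕ) :
    PolyBounded f fun i => p.eval (g i) :=
  hg.trans ⟨p, fun _ => le_rfl⟩

end PolyBounded

/-! ## Sizes and running times -/

theorem Data.size_pos (x : Data) : 1 ≤ x.size := by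
  cases x <;> simp [Data.size]

theorem Data.size_hd_le (x : Data) : x.hd.size ≤ x.size := by
  cases x <;> simp [Data.size, Data.hd]; omega

theorem Data.size_tl_le (x : Data) : x.tl.size ≤ x.size := by
  cases x <;> simp [Data.size, Data.tl]; omega

/-- Elementary operations are charged the size of their input, so a time bound also bounds the size
of the result. This is what keeps compositions polynomial. -/
theorem Run.size_le {c : Prog} {x y : Data} {t : ℕ} (h : Run c x y t) :
    x.size ≤ t ∧ y.size ≤ t := by
  induction h with
  | id x => simp
  | nil x => exact ⟨le_rfl, x.size_pos⟩
  | hd x => exact ⟨le_rfl, x.size_hd_le⟩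
  | tl x => exact ⟨le_rfl, x.size_tl_le⟩
  | pair _ _ _ _ => simp only [Data.size]; omega
  | seq => omega
  | ite_true => omega
  | ite_false => omega
  | loop_stop => omega
  | loop_step => omega

/-- One program computes `v i` from `u i` in polynomial time, for all `i`. -/
def PolyTime {I : Type} (u v : I → Data) : Prop :=
  ∃ (c : Prog) (t : I → ℕ), (∀ i, Run c (u i) (v i) (t i)) ∧ PolyBounded (fun i => (u i).size) t

/-- The truth value of a proposition. -/
noncomputable def truth (P : Prop) : Data :=
  open Classical in if P then .cons .nil .nil else .nil

theorem truth_ne_nil {P : Prop} : truth P ≠ .nil ↔ P := by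
  unfold truth
  split <;> simp [*]

theorem truth_of {P : Prop} (h : P) : truth P = .cons .nil .nil := if_pos h

theorem truth_of_not {P : Prop} (h : ¬ P) : truth P = .nil := if_neg h

namespace PolyTime

variable {I J K X Y Z : Type} {u v w : I → Data}

theorem size_bounded (h : PolyTime u v) :
    PolyBounded (fun i => (u i).size) fun i => (v i).size := by
  obtain ⟨c, t, hr, ht⟩ := h
  exact ht.mono fun i => (hr i).size_le.2

theorem reindex (h : PolyTime u v) (k : J → I) :
    PolyTime (fun j => u (k j)) fun j => v (k j) := by
  obtain ⟨c, t, hr, ht⟩ := h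
  exact ⟨c, fun j => t (k j), fun j => hr (k j), ht.reindex k⟩

theorem refl (u : I → Data) : PolyTime u u :=
  ⟨.id, _, fun _ => .id _, .refl _⟩

theorem nil (u : I → Data) : PolyTime u fun _ => .nil :=
  ⟨.nil, _, fun _ => .nil _, .refl _⟩

theorem trans (h : PolyTime u v) (k : PolyTime v w) : PolyTime u w := by
  have hv := h.size_bounded
  obtain ⟨c, t, hr, ht⟩ := h
  obtain ⟨d, s, kr, ks⟩ := k
  exact ⟨.seq c d, _, fun i => .seq (hr i) (kr i), (ht.add (hv.trans ks)).add (.const _ 1)⟩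

theorem hd (h : PolyTime u v) : PolyTime u fun i => (v i).hd :=
  h.trans ⟨.hd, _, fun _ => .hd _, .refl _⟩

theorem tl (h : PolyTime u v) : PolyTime u fun i => (v i).tl :=
  h.trans ⟨.tl, _, fun _ => .tl _, .refl _⟩

theorem pair (h : PolyTime u v) (k : PolyTime u w) : PolyTime u fun i => .cons (v i) (w i) := by
  obtain ⟨c, t, hr, ht⟩ := h
  obtain ⟨d, s, kr, ks⟩ := k
  exact ⟨.pair c d, _, fun i => .pair (hr i) (kr i), (ht.add ks).add (.const _ 1)⟩

theorem const (u : I → Data) (d : Data) : PolyTime u fun _ => d := by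
  induction d with
  | nil => exact .nil u
  | cons a b ha hb => exact ha.pair hb

theorem congr (h : PolyTime u v) (hv : ∀ i, v i = w i) : PolyTime u w := by
  rwa [← show v = w from funext hv]

/-- Each branch has to be computable only on the instances that reach it, hence the subtypes. Adding
the polynomials of the test and of both branches avoids a maximum. -/
theorem cases {P : I → Prop} {b : I → Data} (hb : PolyTime u b) (hP : ∀ i, b i ≠ .nil ↔ P i)
    (hv : PolyTime (fun i : {i // P i} => u i) fun i => v i)
    (hw : PolyTime (fun i : {i // ¬ P i} => u i) fun i => v i) : PolyTime u v := by
  classical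
  obtain ⟨b', t, hr, p, hp⟩ := hb
  obtain ⟨c, s, hs, q, hq⟩ := hv
  obtain ⟨d, r, kr, q', hq'⟩ := hw
  refine ⟨.ite b' c d, fun i => t i + (if h : P i then s ⟨i, h⟩ else r ⟨i, h⟩) + 1, fun i => ?_,
    p + (q + q') + 1, fun i => ?_⟩
  · beta_reduce
    by_cases h : P i
    · rw [dif_pos h]
      exact .ite_true (hr i) ((hP i).2 h) (hs ⟨i, h⟩)
    · rw [dif_neg h]
      have h0 : b i = .nil := by by_contra h1; exact h ((hP i).1 h1)
      exact .ite_false (h0 ▸ hr i) (kr ⟨i, h⟩)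
  · have := hp i
    simp only [Polynomial.eval_add, Polynomial.eval_one]
    split
    · rename_i h
      have := hq ⟨i, h⟩
      simp only at *
      omega
    · rename_i h
      have := hq' ⟨i, h⟩
      simp only at *
      omega

open Classical in
theorem ite {P : I → Prop} (hP : PolyTime u fun i => truth (P i)) (hv : PolyTime u v)
    (hw : PolyTime u w) : PolyTime u fun i => if P i then v i else w i := by
  refine cases hP (fun i => truth_ne_nil) ((hv.reindex Subtype.val).congr fun i => ?_)
    ((hw.reindex Subtype.val).congr fun i => ?_)
  · rw [if_pos i.2]
  · rw [if_neg i.2]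

theorem truth_ne {P : I → Prop} (hv : PolyTime u v) (hP : ∀ i, v i ≠ .nil ↔ P i) :
    PolyTime u fun i => truth (P i) :=
  cases hv hP ((const _ (.cons .nil .nil)).congr fun i => (truth_of i.2).symm)
    ((const _ .nil).congr fun i => (truth_of_not i.2).symm)

theorem not {P : I → Prop} (hP : PolyTime u fun i => truth (P i)) :
    PolyTime u fun i => truth (¬ P i) := by
  refine (ite hP (const _ .nil) (const _ (.cons .nil .nil))).congr fun i => ?_
  by_cases h : P i <;> simp [h, truth]

theorem and {P Q : I → Prop} (hP : PolyTime u fun i => truth (P i))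
    (hQ : PolyTime u fun i => truth (Q i)) : PolyTime u fun i => truth (P i ∧ Q i) := by
  refine (ite hP hQ (const _ .nil)).congr fun i => ?_
  by_cases h : P i <;> by_cases k : Q i <;> simp [h, k, truth]

/-- Loops, with an invariant that bounds the size and determines the result, and a measure that
bounds the number of iterations. -/
theorem loop {σ w : K → Data} {go : K → Prop} {next : K → K} {μ : K → ℕ} {inv : I → K → Prop}
    {k₀ : I → K} {res : I → Data} {B : I → ℕ}
    (hw : PolyTime σ w) (hgo : ∀ k, w k ≠ .nil ↔ go k)
    (hnext : PolyTime (fun k : {k // go k} => σ k) fun k => σ (next k))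
    (hμ : ∀ k, go k → μ (next k) < μ k)
    (hinv : ∀ i, inv i (k₀ i)) (hstep : ∀ i k, inv i k → go k → inv i (next k))
    (hres : ∀ i k, inv i k → ¬ go k → σ k = res i)
    (hsize : ∀ i k, inv i k → (σ k).size ≤ B i)
    (hB : PolyBounded (fun i => (σ (k₀ i)).size) B)
    (hμ0 : PolyBounded (fun i => (σ (k₀ i)).size) fun i => μ (k₀ i)) :
    PolyTime (fun i => σ (k₀ i)) res := by
  obtain ⟨b, t, hr, p, hp⟩ := hw
  obtain ⟨f, s, hs, q, hq⟩ := hnext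
  -- Every configuration met has size at most `B i`, so a round costs at most `p (B i) + q (B i) +
  -- 1`. The factor `n + 1` counts at most `n` rounds and the final test.
  have key : ∀ i n k, inv i k → μ k ≤ n → ∃ r, Run (.loop b f) (σ k) (res i) r ∧
      r ≤ (n + 1) * (p.eval (B i) + q.eval (B i) + 1) := by
    intro i n
    induction n with
    | zero =>
      intro k hk hn
      have hg : ¬ go k := fun hg => by have := hμ k hg; omega
      have h0 : w k = .nil := by by_contra h1; exact hg ((hgo k).1 h1)
      have h1 := (hp k).trans (eval_mono_nat p (hsize i k hk))
      rw [← hres i k hk hg]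
      exact ⟨_, Run.loop_stop (h0 ▸ hr k), by simp only at h1; omega⟩
    | succ n ih =>
      intro k hk hn
      have h1 := (hp k).trans (eval_mono_nat p (hsize i k hk))
      by_cases hg : go k
      · have h2 := (hq ⟨k, hg⟩).trans (eval_mono_nat q (hsize i k hk))
        obtain ⟨r, hr1, hr2⟩ := ih (next k) (hstep i k hk hg) (by have := hμ k hg; omega)
        refine ⟨_, .loop_step (hr k) ((hgo k).2 hg) (hs ⟨k, hg⟩) hr1, ?_⟩
        simp only at h1 h2
        rw [add_mul (n + 1) 1, one_mul]
        omega
      · have h0 : w k = .nil := by by_contra h1; exact hg ((hgo k).1 h1)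
        rw [← hres i k hk hg]
        refine ⟨_, Run.loop_stop (h0 ▸ hr k), ?_⟩
        simp only at h1
        rw [add_mul (n + 1) 1, one_mul]
        omega
  choose r hr1 hr2 using fun i => key i _ (k₀ i) (hinv i) le_rfl
  exact ⟨_, r, hr1, PolyBounded.mono ((hμ0.add (.const _ 1)).mul
    (((hB.eval p).add (hB.eval q)).add (.const _ 1))) hr2⟩

end PolyTime

theorem polyTimeDecidable_iff {I : Type} {code : I → Data} {L : I → Prop} :
    PolyTimeDecidable code L ↔ PolyTime code fun i => truth (L i) := by
  constructor
  · rintro ⟨c, p, h⟩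
    choose y t hr ht hy using h
    exact PolyTime.truth_ne ⟨c, t, hr, p, ht⟩ hy
  · rintro ⟨c, t, hr, p, hp⟩
    exact ⟨c, p, fun i => ⟨_, _, hr i, hp i, truth_ne_nil⟩⟩

/-! ## Equality of trees -/

namespace DataEq

/-- Configurations of the equality test: pairs still to be compared, and whether a mismatch has
been found. -/
abbrev Config : Type := List (Data × Data) × Prop

/-- The code of a configuration. -/
noncomputable def code (k : Config) : Data :=
  .cons (Coding.list (fun x : Data × Data => .cons x.1 x.2) k.1) (truth k.2)

/-- One step of the comparison. -/
def next : Config → Config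
  | ([], b) => ([], b)
  | ((.nil, .nil) :: l, b) => (l, b)
  | ((.cons a₁ a₂, .cons b₁ b₂) :: l, b) => ((a₁, b₁) :: (a₂, b₂) :: l, b)
  | ((.nil, .cons _ _) :: _, _) => ([], True)
  | ((.cons _ _, .nil) :: _, _) => ([], True)

/-- The number of nodes still to be visited. -/
def measure (k : Config) : ℕ := (k.1.map fun x => x.1.size).sum

theorem measure_next (k : Config) (hk : k.1 ≠ []) : measure (next k) < measure k := by
  obtain ⟨_ | ⟨⟨a, b⟩, l⟩, P⟩ := k
  · exact absurd rfl hk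
  · rcases a with _ | ⟨a₁, a₂⟩ <;> rcases b with _ | ⟨b₁, b₂⟩ <;>
      simp only [measure, next, List.map_cons, List.map_nil, List.sum_cons, List.sum_nil,
        Data.size] <;> omega

theorem size_truth_le (P : Prop) : (truth P).size ≤ 3 := by
  unfold truth
  split <;> simp [Data.size]

/-- Splitting a pair of `cons` nodes into two pairs keeps the total number of nodes, and a mismatch
discards all remaining pairs. The test therefore never needs more space than its input. -/
theorem size_next_le (k : Config) (hk : k.1 ≠ []) : (code (next k)).size ≤ (code k).size := by
  obtain ⟨_ | ⟨⟨a, b⟩, l⟩, P⟩ := k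
  · exact absurd rfl hk
  · have := size_truth_le True
    have := (truth P).size_pos
    have := (Coding.list (fun x : Data × Data => Data.cons x.1 x.2) l).size_pos
    rcases a with _ | ⟨a₁, a₂⟩ <;> rcases b with _ | ⟨b₁, b₂⟩ <;>
      simp only [code, next, Coding.list, List.map_cons, List.map_nil, Data.ofList,
        Data.size] at * <;> (try have := a₁.size_pos) <;> (try have := b₁.size_pos) <;> omega

/-- The loop invariant of the equality test: once no pairs remain, the flag alone tells whether the
original trees differ. -/
theorem mismatch_next (k : Config) :
    ((next k).2 ∨ ∃ x ∈ (next k).1, x.1 ≠ x.2) ↔ (k.2 ∨ ∃ x ∈ k.1, x.1 ≠ x.2) := by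
  obtain ⟨_ | ⟨⟨a, b⟩, l⟩, P⟩ := k
  · rfl
  · rcases a with _ | ⟨a₁, a₂⟩ <;> rcases b with _ | ⟨b₁, b₂⟩ <;> simp [next]
    tauto

theorem polyTime_next :
    PolyTime (fun k : {k : Config // k.1 ≠ []} => code k) fun k => code (next k) := by
  have h : PolyTime (fun k : {k : Config // k.1 ≠ []} => code k) fun k => code k := .refl _
  have ha := PolyTime.truth_ne h.hd.hd.hd fun _ => Iff.rfl
  have hb := PolyTime.truth_ne h.hd.hd.tl fun _ => Iff.rfl
  have hf : PolyTime (fun k : {k : Config // k.1 ≠ []} => code k) fun _ => code ([], True) :=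
    .const _ _
  refine (PolyTime.ite ha (PolyTime.ite hb
    (((h.hd.hd.hd.hd.pair h.hd.hd.tl.hd).pair
      ((h.hd.hd.hd.tl.pair h.hd.hd.tl.tl).pair h.hd.tl)).pair h.tl) hf)
    (PolyTime.ite hb hf (h.hd.tl.pair h.tl))).congr ?_
  rintro ⟨⟨_ | ⟨⟨a, b⟩, l⟩, P⟩, hk⟩
  · exact absurd rfl hk
  · rcases a with _ | ⟨a₁, a₂⟩ <;> rcases b with _ | ⟨b₁, b₂⟩ <;>
      simp [code, next, Coding.list, Data.ofList, Data.hd, Data.tl]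

end DataEq

namespace PolyTime

variable {I J X Y Z : Type} {u v w : I → Data}

theorem eq (hv : PolyTime u v) (hw : PolyTime u w) : PolyTime u fun i => truth (v i = w i) := by
  have h0 : PolyTime u fun i => DataEq.code ([(v i, w i)], False) :=
    ((((hv.pair hw).pair (const _ .nil)).pair (const _ .nil))).congr fun i => by
      simp [DataEq.code, Coding.list, Data.ofList, truth]
  have h1 : PolyTime (fun i => DataEq.code ([(v i, w i)], False))
      (fun i => .cons .nil (truth (v i ≠ w i))) := by
    refine loop (inv := fun i k => (DataEq.code k).size ≤ (DataEq.code ([(v i, w i)], False)).size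
      ∧ ((k.2 ∨ ∃ x ∈ k.1, x.1 ≠ x.2) ↔ v i ≠ w i)) (refl DataEq.code).hd
      (fun k => ?_) DataEq.polyTime_next DataEq.measure_next (fun i => ?_)
      (fun i k hk hg => ?_) (fun i k hk hg => ?_) (fun i k hk => hk.1) (.refl _) ?_
    · obtain ⟨_ | ⟨x, l⟩, P⟩ := k <;> simp [DataEq.code, Coding.list, Data.ofList, Data.hd]
    · simp
    · exact ⟨(DataEq.size_next_le k hg).trans hk.1, (DataEq.mismatch_next k).trans hk.2⟩
    · obtain ⟨l, P⟩ := k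
      obtain rfl : l = [] := by simpa using hg
      have h : P ↔ v i ≠ w i := by simpa using hk.2
      simp [DataEq.code, Coding.list, Data.ofList, h]
    · refine (PolyBounded.refl _).mono fun i => ?_
      simp only [DataEq.measure, DataEq.code, Coding.list, Data.ofList, List.map_cons,
        List.map_nil, List.sum_cons, List.sum_nil, Data.size]
      omega
  refine (not (truth_ne (h0.trans h1).tl fun i => truth_ne_nil)).congr fun i => ?_
  simp

end PolyTime

/-! ## Lists -/

namespace Coding

variable {X : Type} (c : X → Data)

theorem list_nil : Coding.list c [] = .nil := rfl

theorem list_cons (x : X) (l : List X) :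
    Coding.list c (x :: l) = .cons (c x) (Coding.list c l) := rfl

theorem list_ne_nil {l : List X} : Coding.list c l ≠ .nil ↔ l ≠ [] := by
  cases l <;> simp [list_nil, list_cons]

theorem size_list (l : List X) :
    (Coding.list c l).size = (l.map fun x => (c x).size + 1).sum + 1 := by
  induction l with
  | nil => rfl
  | cons x l ih => rw [list_cons, Data.size, ih, List.map_cons, List.sum_cons]; ring

theorem size_list_append (l m : List X) :
    (Coding.list c (l ++ m)).size + 1 = (Coding.list c l).size + (Coding.list c m).size := by
  simp only [size_list, List.map_append, List.sum_append]
  ring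

theorem size_list_reverse (l : List X) :
    (Coding.list c l.reverse).size = (Coding.list c l).size := by
  simp only [size_list, List.map_reverse, List.sum_reverse]

theorem length_le_size_list (l : List X) : l.length ≤ (Coding.list c l).size := by
  induction l with
  | nil => simp
  | cons x l ih => rw [list_cons, Data.size, List.length_cons]; omega

theorem size_le_of_mem {x : X} {l : List X} (h : x ∈ l) :
    (c x).size ≤ (Coding.list c l).size := by
  induction l with
  | nil => simp at h
  | cons y l ih =>
    rw [list_cons, Data.size]
    rcases List.mem_cons.1 h with rfl | h
    · omega
    · have := ih h
      omega

theorem size_list_le_of_prefix {l m : List X} (h : l <+: m) :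
    (Coding.list c l).size ≤ (Coding.list c m).size := by
  obtain ⟨k, rfl⟩ := h
  have := size_list_append c l k
  have := (Coding.list c k).size_pos
  omega

theorem size_list_flatMap_le {Y : Type} (G : Y → List X) (B : ℕ) (l : List Y)
    (h : ∀ y ∈ l, (Coding.list c (G y)).size ≤ B) :
    (Coding.list c (l.flatMap G)).size ≤ l.length * B + 1 := by
  induction l with
  | nil => simp [list_nil, Data.size]
  | cons y l ih =>
    have h1 := size_list_append c (G y) (l.flatMap G)
    have h2 := h y (by simp)
    have h3 := ih fun z hz => h z (by simp [hz])
    rw [List.flatMap_cons, List.length_cons, add_mul, one_mul]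
    omega

end Coding

namespace PolyTime

variable {I J X Y Z : Type} {u v w : I → Data} {cX : X → Data} {cY : Y → Data} {cZ : Z → Data}

/-- Bodies of iterations run on the instance paired with local data; this transfers computations on
the instance alone to that setting. -/
theorem outer {v : I → Data} (h : PolyTime u v) {w : I × J → Data} :
    PolyTime (fun j : I × J => .cons (u j.1) (w j)) fun j => v j.1 :=
  ((refl fun j : I × J => Data.cons (u j.1) (w j)).hd).trans (h.reindex Prod.fst)

/-- A polynomial-time body alone is not enough, since it could double the accumulator in each round.
Hence the separate bound, uniform over all prefixes of the list. The input `u i` is carried through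
the loop because the body may depend on it. -/
theorem foldl {L : I → List X} {a : I → Y} {F : I → Y → X → Y}
    (hL : PolyTime u fun i => Coding.list cX (L i)) (ha : PolyTime u fun i => cY (a i))
    (hF : PolyTime (fun j : I × Y × X => .cons (u j.1) (.cons (cY j.2.1) (cX j.2.2)))
      fun j => cY (F j.1 j.2.1 j.2.2))
    (hB : PolyBounded (fun i => (u i).size) (fun i => (Coding.list cX (L i)).size) →
      ∃ B : I → ℕ, PolyBounded (fun i => (u i).size) B ∧
        ∀ i l, l <+: L i → (cY (l.foldl (F i) (a i))).size ≤ B i) :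
    PolyTime u fun i => cY ((L i).foldl (F i) (a i)) := by
  have hLs := hL.size_bounded
  obtain ⟨B, hB, hBle⟩ := hB hLs
  let σ : List X × I × Y → Data := fun k =>
    .cons (Coding.list cX k.1) (.cons (u k.2.1) (cY k.2.2))
  let next : List X × I × Y → List X × I × Y := fun k => match k with
    | ([], i, y) => ([], i, y)
    | (x :: l, i, y) => (l, i, F i y x)
  have hσ : PolyTime (fun k : {k : List X × I × Y // k.1 ≠ []} => σ k) fun k => σ k := .refl _
  have hnext : PolyTime (fun k : {k : List X × I × Y // k.1 ≠ []} => σ k)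
      fun k => σ (next k) := by
    have h1 := hF.reindex fun k : {k : List X × I × Y // k.1 ≠ []} =>
      (k.1.2.1, k.1.2.2, k.1.1.head k.2)
    have h2 : PolyTime (fun k : {k : List X × I × Y // k.1 ≠ []} => σ k) fun k =>
        .cons (u k.1.2.1) (.cons (cY k.1.2.2) (cX (k.1.1.head k.2))) :=
      (hσ.tl.hd.pair (hσ.tl.tl.pair hσ.hd.hd)).congr fun k => by
        obtain ⟨⟨_ | ⟨x, l⟩, i, y⟩, hk⟩ := k
        · exact absurd rfl hk
        · rfl
    refine (hσ.hd.tl.pair (hσ.tl.hd.pair (h2.trans h1))).congr fun k => ?_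
    obtain ⟨⟨_ | ⟨x, l⟩, i, y⟩, hk⟩ := k
    · exact absurd rfl hk
    · rfl
  have h0 : PolyTime u fun i => σ (L i, i, a i) := hL.pair ((refl u).pair ha)
  have hu : PolyBounded (fun i => (σ (L i, i, a i)).size) fun i => (u i).size :=
    (PolyBounded.refl _).mono fun i => by simp only [σ, Data.size]; omega
  have h1 : PolyTime (fun i => σ (L i, i, a i))
      (fun i => σ ([], i, (L i).foldl (F i) (a i))) := by
    refine loop (inv := fun i k => k.2.1 = i ∧ ∃ l, L i = l ++ k.1 ∧
        k.2.2 = l.foldl (F i) (a i)) (go := fun k => k.1 ≠ []) (μ := fun k => k.1.length)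
      (refl σ).hd (fun k => by exact Coding.list_ne_nil cX (l := k.1)) hnext
      (fun k hk => ?_) (fun i => ⟨rfl, [], rfl, rfl⟩) (fun i k hk hg => ?_) (fun i k hk hg => ?_)
      (fun i k hk => ?_) (hu.trans (((hLs.add (.refl _)).add hB).add (.const _ 2))) ?_
    · obtain ⟨_ | ⟨x, l⟩, i, y⟩ := k
      · exact absurd rfl hk
      · simp [next]
    · obtain ⟨_ | ⟨x, l⟩, i', y⟩ := k
      · exact absurd rfl hg
      · obtain ⟨rfl, l', h1, h2⟩ := hk
        dsimp only at h1 h2 ⊢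
        exact ⟨rfl, l' ++ [x], by simp [next, h1], by simp [next, h2]⟩
    · obtain ⟨l, i', y⟩ := k
      obtain ⟨rfl, l', h1, h2⟩ := hk
      dsimp only at h1 h2 hg
      obtain rfl : l = [] := by simpa using hg
      simp only [List.append_nil] at h1
      simp only [σ, h1, h2]
    · obtain ⟨l, i', y⟩ := k
      obtain ⟨rfl, l', h1, h2⟩ := hk
      dsimp only at h1 h2
      have h3 := hBle i' l' ⟨l, h1.symm⟩
      have h4 := Coding.size_list_append cX l' l
      have h5 := (Coding.list cX l').size_pos
      simp only [σ, Data.size, h2, h1] at *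
      omega
    · exact hu.trans (hLs.mono fun i => Coding.length_le_size_list _ _)
  exact ((h0.trans h1).tl.tl).congr fun i => rfl

theorem foldl_cons_eq (l m : List X) :
    l.foldl (fun acc x => x :: acc) m = l.reverse ++ m := by
  induction l generalizing m with
  | nil => rfl
  | cons x l ih => simp [ih]

theorem reverseAppend {L M : I → List X} (hL : PolyTime u fun i => Coding.list cX (L i))
    (hM : PolyTime u fun i => Coding.list cX (M i)) :
    PolyTime u fun i => Coding.list cX ((L i).reverse ++ M i) := by
  refine (foldl (cY := Coding.list cX) (F := fun _ acc x => x :: acc) hL hM ?_ ?_).congr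
    fun i => by rw [foldl_cons_eq]
  · exact (refl _).tl.tl.pair (refl _).tl.hd
  · refine fun hLs => ⟨_, hLs.add hM.size_bounded, fun i l hl => ?_⟩
    rw [foldl_cons_eq]
    have h1 := Coding.size_list_append cX l.reverse (M i)
    have h2 := Coding.size_list_le_of_prefix cX hl
    rw [Coding.size_list_reverse] at h1
    omega

theorem reverse {L : I → List X} (hL : PolyTime u fun i => Coding.list cX (L i)) :
    PolyTime u fun i => Coding.list cX (L i).reverse :=
  (reverseAppend hL (M := fun _ => []) (const _ .nil)).congr fun i => by simp

theorem append {L M : I → List X} (hL : PolyTime u fun i => Coding.list cX (L i))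
    (hM : PolyTime u fun i => Coding.list cX (M i)) :
    PolyTime u fun i => Coding.list cX (L i ++ M i) :=
  (reverseAppend hL.reverse hM).congr fun i => by simp

theorem flatMap {L : I → List X} {G : I → X → List Z}
    (hL : PolyTime u fun i => Coding.list cX (L i))
    (hG : PolyTime (fun j : I × X => .cons (u j.1) (cX j.2))
      fun j => Coding.list cZ (G j.1 j.2)) :
    PolyTime u fun i => Coding.list cZ ((L i).flatMap (G i)) := by
  have key : ∀ i (l : List X) m, l.foldl (fun acc x => (G i x).reverse ++ acc) m =
      (l.flatMap (G i)).reverse ++ m := by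
    intro i l
    induction l with
    | nil => simp
    | cons x l ih => intro m; simp [ih]
  have h : PolyTime u fun i => Coding.list cZ
      ((L i).foldl (fun acc x => (G i x).reverse ++ acc) []) := by
    refine foldl (cY := Coding.list cZ) (F := fun i acc x => (G i x).reverse ++ acc) hL
      (const _ .nil) ?_ fun hLs => ?_
    · have h0 := refl fun j : I × List Z × X =>
        Data.cons (u j.1) (.cons (Coding.list cZ j.2.1) (cX j.2.2))
      exact reverseAppend ((h0.hd.pair h0.tl.tl).trans (hG.reindex fun j : I × List Z × X => (j.1, j.2.2)))
        h0.tl.hd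
    · obtain ⟨p, hp⟩ := hG.size_bounded
      refine ⟨_, (hLs.mul ((((PolyBounded.refl _).add hLs).add (.const _ 1)).eval p)).add
        (.const _ 1), fun i l hl => ?_⟩
      rw [key, List.append_nil, Coding.size_list_reverse]
      refine (Coding.size_list_flatMap_le cZ _ _ l fun x hx => ?_).trans
        (Nat.add_le_add_right (Nat.mul_le_mul_right _ ?_) 1)
      · refine (hp (i, x)).trans (eval_mono_nat p ?_)
        have := Coding.size_le_of_mem cX (hl.subset hx)
        simp only [Data.size]
        omega
      · exact hl.length_le.trans (Coding.length_le_size_list cX _)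
  exact h.reverse.congr fun i => by rw [key]; simp

theorem singleton {z : I → Z} (hz : PolyTime u fun i => cZ (z i)) :
    PolyTime u fun i => Coding.list cZ [z i] :=
  hz.pair (const _ .nil)

theorem cons {z : I → Z} {L : I → List Z} (hz : PolyTime u fun i => cZ (z i))
    (hL : PolyTime u fun i => Coding.list cZ (L i)) :
    PolyTime u fun i => Coding.list cZ (z i :: L i) :=
  hz.pair hL

theorem iteSingleton {z : I → Z} {P : I → Prop} [∀ i, Decidable (P i)] (hP : PolyTime u fun i => truth (P i))
    (hz : PolyTime u fun i => cZ (z i)) :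
    PolyTime u fun i => Coding.list cZ (if P i then [z i] else []) :=
  (ite hP hz.singleton (const _ .nil)).congr fun i => by
    by_cases h : P i <;> simp [h, Coding.list_nil, Coding.list_cons]

theorem map {L : I → List X} {G : I → X → Z} (hL : PolyTime u fun i => Coding.list cX (L i))
    (hG : PolyTime (fun j : I × X => .cons (u j.1) (cX j.2)) fun j => cZ (G j.1 j.2)) :
    PolyTime u fun i => Coding.list cZ ((L i).map (G i)) :=
  (flatMap (G := fun i x => [G i x]) hL hG.singleton).congr fun i => by
    rw [List.map_eq_flatMap]

/-- One unit is collected per witness; the resulting list is nonempty exactly when there is a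
witness. -/
theorem exists_mem {L : I → List X} {P : I → X → Prop}
    (hL : PolyTime u fun i => Coding.list cX (L i))
    (hP : PolyTime (fun j : I × X => .cons (u j.1) (cX j.2)) fun j => truth (P j.1 j.2)) :
    PolyTime u fun i => truth (∃ x ∈ L i, P i x) := by
  classical
  refine truth_ne (flatMap (cZ := fun _ : Unit => .nil)
    (G := fun i x => if P i x then [()] else []) hL
    (iteSingleton (z := fun _ => ()) hP (const _ .nil)))
    fun i => ?_
  rw [Coding.list_ne_nil, ne_eq, List.flatMap_eq_nil_iff]
  simp

theorem mem {L : I → List X} {x : I → X} (hc : Function.Injective cX)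
    (hx : PolyTime u fun i => cX (x i)) (hL : PolyTime u fun i => Coding.list cX (L i)) :
    PolyTime u fun i => truth (x i ∈ L i) :=
  (exists_mem (P := fun i y => y = x i) hL ((eq (refl _).tl hx.outer).congr fun j => by
    exact congrArg truth (propext hc.eq_iff))).congr fun i => by simp

end PolyTime

/-! ## Horn clauses -/

/-- The facts that follow from `a` by the clauses in `C`; the clause `(x, y, z)` says that `x` and
`y` imply `z`. -/
inductive Derivable {F : Type} (C : List (F × F × F)) (a : F) : F → Prop
  | init : Derivable C a a
  | step {x y z : F} : (x, y, z) ∈ C → Derivable C a x → Derivable C a y → Derivable C a z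

open Classical in
/-- The fact `a` and the conclusions of the clauses with premises in `l`. -/
noncomputable def hornStep {F : Type} (C : List (F × F × F)) (a : F) (l : List F) : List F :=
  a :: C.flatMap fun c => if c.1 ∈ l ∧ c.2.1 ∈ l then [c.2.2] else []

/-- Forward chaining, with as many rounds as there are clauses. -/
noncomputable def horn {F : Type} (C : List (F × F × F)) (a : F) : List F :=
  C.foldl (fun l _ => hornStep C a l) [a]

section

variable {F : Type} {C : List (F × F × F)} {a : F}

theorem mem_hornStep {l : List F} {z : F} :
    z ∈ hornStep C a l ↔ z = a ∨ ∃ x y, (x, y, z) ∈ C ∧ x ∈ l ∧ y ∈ l := by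
  simp only [hornStep, List.mem_cons, List.mem_flatMap, List.mem_ite_nil_right, Prod.exists]
  refine or_congr_right ⟨?_, ?_⟩
  · rintro ⟨x, y, z, h, ⟨hx, hy⟩, hz⟩
    obtain rfl : _ = z := by simpa using hz
    exact ⟨x, y, h, hx, hy⟩
  · rintro ⟨x, y, h, hx, hy⟩
    exact ⟨x, y, z, h, ⟨hx, hy⟩, by simp⟩

theorem hornStep_mono {l m : List F} (h : l ⊆ m) : hornStep C a l ⊆ hornStep C a m := by
  intro z hz
  rw [mem_hornStep] at hz ⊢
  exact hz.imp_right fun ⟨x, y, hc, hx, hy⟩ => ⟨x, y, hc, h hx, h hy⟩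

theorem foldl_const_eq_iterate {X Y : Type} (f : Y → Y) (l : List X) (y : Y) :
    l.foldl (fun y _ => f y) y = f^[l.length] y := by
  induction l generalizing y with
  | nil => rfl
  | cons x l ih => rw [List.foldl_cons, ih]; rfl

theorem subset_iterate_hornStep (n : ℕ) :
    (hornStep C a)^[n] [a] ⊆ (hornStep C a)^[n + 1] [a] := by
  induction n with
  | zero => intro z hz; exact mem_hornStep.2 (.inl (by simpa using hz))
  | succ n ih =>
    rw [Function.iterate_succ_apply', Function.iterate_succ_apply' _ (n + 1)]
    exact hornStep_mono ih

/-- The clauses with premises in `l`. -/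
def firing (C : List (F × F × F)) (l : List F) : Set (F × F × F) :=
  {c | c ∈ C ∧ c.1 ∈ l ∧ c.2.1 ∈ l}

theorem finite_firing (l : List F) : (firing C l).Finite :=
  C.finite_toSet.subset fun _ hc => hc.1

/-- A round that adds a fact must use a clause that did not fire before, so the number of firing
clauses grows with every productive round. Hence there are at most `C.length` productive rounds. -/
theorem lt_ncard_firing (n : ℕ)
    (h : ¬ (hornStep C a)^[n + 1] [a] ⊆ (hornStep C a)^[n] [a]) :
    n < (firing C ((hornStep C a)^[n] [a])).ncard := by
  induction n with
  | zero =>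
    rw [Set.ncard_pos (finite_firing _)]
    by_contra h0
    refine h fun z hz => ?_
    rcases mem_hornStep.1 hz with rfl | ⟨x, y, hc, hx, hy⟩
    · simp
    · exact absurd ⟨(x, y, z), hc, hx, hy⟩ h0
  | succ n ih =>
    have h1 : ¬ (hornStep C a)^[n + 1] [a] ⊆ (hornStep C a)^[n] [a] := by
      intro h1
      have h2 := hornStep_mono (C := C) (a := a) h1
      rw [← Function.iterate_succ_apply' (hornStep C a),
        ← Function.iterate_succ_apply' (hornStep C a)] at h2
      exact h h2
    -- If the same clauses fired at stages `n` and `n + 1`, the next round would produce nothing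
    -- beyond stage `n + 1`, contrary to `h`.
    refine (Nat.succ_le_of_lt (ih h1)).trans_lt (Set.ncard_lt_ncard ?_ (finite_firing _))
    refine ⟨fun c hc => ⟨hc.1, subset_iterate_hornStep n hc.2.1,
      subset_iterate_hornStep n hc.2.2⟩, fun h2 => h ?_⟩
    intro z hz
    rw [Function.iterate_succ_apply'] at hz
    rcases mem_hornStep.1 hz with rfl | ⟨x, y, hc, hx, hy⟩
    · rw [Function.iterate_succ_apply']
      exact mem_hornStep.2 (.inl rfl)
    · have h3 := h2 ⟨hc, hx, hy⟩
      rw [Function.iterate_succ_apply']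
      exact mem_hornStep.2 (.inr ⟨x, y, hc, h3.2.1, h3.2.2⟩)

theorem mem_horn {z : F} : z ∈ horn C a ↔ Derivable C a z := by
  classical
  rw [horn, foldl_const_eq_iterate]
  have closed : (hornStep C a)^[C.length + 1] [a] ⊆ (hornStep C a)^[C.length] [a] := by
    by_contra h
    refine absurd (lt_ncard_firing _ h) (not_lt.2 ?_)
    calc (firing C _).ncard ≤ (C.toFinset : Set (F × F × F)).ncard :=
          Set.ncard_le_ncard (fun c hc => by simpa using hc.1) (Finset.finite_toSet _)
      _ ≤ C.length := by rw [Set.ncard_coe_finset]; exact C.toFinset_card_le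
  rw [Function.iterate_succ_apply'] at closed
  constructor
  · generalize C.length = n
    intro h
    induction n generalizing z with
    | zero => obtain rfl : z = a := by simpa using h
              exact .init
    | succ n ih =>
      rw [Function.iterate_succ_apply'] at h
      rcases mem_hornStep.1 h with rfl | ⟨x, y, hc, hx, hy⟩
      · exact .init
      · exact .step hc (ih hx) (ih hy)
  · intro h
    induction h with
    | init => exact closed (mem_hornStep.2 (.inl rfl))
    | step hc _ _ hx hy => exact closed (mem_hornStep.2 (.inr ⟨_, _, hc, hx, hy⟩))

end

/-- The code of a Horn clause. -/
def clauseCode {F : Type} (cF : F → Data) (c : F × F × F) : Data :=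
  .cons (cF c.1) (.cons (cF c.2.1) (cF c.2.2))

-- Forward chaining in polynomial time

namespace PolyTime

variable {I F : Type} {u : I → Data} {cF : F → Data}

/-- Each clause contributes its conclusion at most once, and its code contains that of the
conclusion. The bound does not depend on `l`, so sizes do not build up over the rounds; this is why
a round recomputes the list instead of extending it. -/
theorem size_list_hornStep_le (C : List (F × F × F)) (a : F) (l : List F) :
    (Coding.list cF (hornStep C a l)).size ≤
      (cF a).size + (Coding.list (clauseCode cF) C).size + 1 := by
  classical
  suffices h : (Coding.list cF
      (C.flatMap fun c => if c.1 ∈ l ∧ c.2.1 ∈ l then [c.2.2] else [])).size ≤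
        (Coding.list (clauseCode cF) C).size by
    rw [hornStep, Coding.list_cons, Data.size]
    omega
  induction C with
  | nil => simp [Coding.list_nil]
  | cons c C ih =>
    have h1 := Coding.size_list_append cF (if c.1 ∈ l ∧ c.2.1 ∈ l then [c.2.2] else [])
      (C.flatMap fun c => if c.1 ∈ l ∧ c.2.1 ∈ l then [c.2.2] else [])
    have h2 : (Coding.list cF (if c.1 ∈ l ∧ c.2.1 ∈ l then [c.2.2] else [])).size ≤
        (cF c.2.2).size + 2 := by
      split <;> simp [Coding.list_cons, Coding.list_nil, Data.size]
    rw [List.flatMap_cons, Coding.list_cons, Data.size, clauseCode, Data.size, Data.size]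
    omega

theorem horn {C : I → List (F × F × F)} {a : I → F} (hc : Function.Injective cF)
    (hC : PolyTime u fun i => Coding.list (clauseCode cF) (C i))
    (ha : PolyTime u fun i => cF (a i)) :
    PolyTime u fun i => Coding.list cF (UnorderedTrees.horn (C i) (a i)) := by
  refine foldl (cY := Coding.list cF) (F := fun i l _ => hornStep (C i) (a i) l) hC ha.singleton
    ?_ fun hCs => ?_
  · classical
    have h0 := refl fun j : I × List F × F × F × F =>
      Data.cons (u j.1) (.cons (Coding.list cF j.2.1) (clauseCode cF j.2.2))
    have hl := h0.tl.hd
    refine cons ha.outer (flatMap hC.outer (iteSingleton (and ?_ ?_) ?_))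
    · exact mem hc (refl _).tl.hd hl.outer
    · exact mem hc (refl _).tl.tl.hd hl.outer
    · exact (refl _).tl.tl.tl
  · refine ⟨_, (ha.size_bounded.add hCs).add (.const _ 2), fun i l _ => ?_⟩
    have h1 := (Coding.list (clauseCode cF) (C i)).size_pos
    induction l using List.reverseRecOn with
    | nil => simp only [List.foldl_nil, Coding.list_cons, Coding.list_nil, Data.size]; omega
    | append_singleton l c _ =>
      rw [List.foldl_append, List.foldl_cons, List.foldl_nil]
      have := size_list_hornStep_le (cF := cF) (C i) (a i)
        (l.foldl (fun l _ => hornStep (C i) (a i) l) [a i])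
      omega

end PolyTime

/-! ## Joint satisfiability of filters -/

/-- Some pair `(d, Q)`, with `Q` empty or a singleton, satisfies all filters in `l`. -/
def JointlySatisfiable {α QQ : Type} {Pat : Set (Pattern α)} (l : List (EdgeFilter α QQ Pat)) :
    Prop :=
  ∃ (d : List α) (Q : Set QQ), Q.Subsingleton ∧ ∀ f ∈ l, f.Sat (d, Q)

section

variable {α QQ : Type} {Pat : Set (Pattern α)}

theorem sat_foldl_and (x : List α × Set QQ) (l : List (EdgeFilter α QQ Pat))
    (f : EdgeFilter α QQ Pat) :
    (l.foldl EdgeFilter.and f).Sat x ↔ ∀ g ∈ f :: l, g.Sat x := by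
  induction l generalizing f with
  | nil => simp
  | cons g l ih => rw [List.foldl_cons, ih]; simp [EdgeFilter.Sat, and_assoc]

/-- A conjunction has 7 nodes besides its operands: 5 for the tag and 2 for the pairing. This gives
linear growth, as the bound in `PolyTime.foldl` needs. -/
theorem size_code_foldl_and (cA : α → Data) (cQ : QQ → Data) (l : List (EdgeFilter α QQ Pat))
    (f : EdgeFilter α QQ Pat) :
    ((l.foldl EdgeFilter.and f).code cA cQ).size + 7 ≤
      (f.code cA cQ).size + 7 * (Coding.list (EdgeFilter.code cA cQ) l).size := by
  induction l generalizing f with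
  | nil => simp [Coding.list_nil, Data.size]
  | cons g l ih =>
    have := ih (f.and g)
    rw [List.foldl_cons, Coding.list_cons, Data.size]
    simp only [EdgeFilter.code, Data.size] at *
    omega

variable {I : Type} {u : I → Data} {cA : α → Data} {cQ : QQ → Data}

theorem PolyTime.jointlySatisfiable
    (hsat : PolyTime (fun f : EdgeFilter α QQ Pat => f.code cA cQ)
      fun f => truth f.SingletonSatisfiable)
    {L : I → List (EdgeFilter α QQ Pat)}
    (hL : PolyTime u fun i => Coding.list (EdgeFilter.code cA cQ) (L i)) :
    PolyTime u fun i => truth (JointlySatisfiable (L i)) := by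
  refine cases hL (fun i => Coding.list_ne_nil _) ?_ ?_
  · have hL' := hL.reindex fun i : {i // L i ≠ []} => i.1
    have hcons : ∀ i : {i // L i ≠ []}, ∃ f l, L i.1 = f :: l := fun i =>
      List.exists_cons_of_ne_nil i.2
    choose f l hfl using hcons
    have hf : PolyTime (fun i : {i // L i ≠ []} => u i) fun i => (f i).code cA cQ :=
      hL'.hd.congr fun i => by rw [hfl]; rfl
    have hl : PolyTime (fun i : {i // L i ≠ []} => u i) fun i =>
        Coding.list (EdgeFilter.code cA cQ) (l i) := hL'.tl.congr fun i => by rw [hfl]; rfl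
    have hand : PolyTime (fun i : {i // L i ≠ []} => u i) fun i =>
        ((l i).foldl EdgeFilter.and (f i)).code cA cQ := by
      refine foldl (cY := EdgeFilter.code cA cQ) (F := fun _ => EdgeFilter.and) hl hf
        ((const _ _).pair ((refl _).tl.hd.pair (refl _).tl.tl)) fun hls =>
          ⟨_, hf.size_bounded.add ((PolyBounded.const _ 7).mul hls), fun i m hm => ?_⟩
      have h1 := size_code_foldl_and cA cQ m (f i)
      have h2 := Coding.size_list_le_of_prefix (EdgeFilter.code cA cQ) hm
      omega
    refine (hand.trans (hsat.reindex fun i => (l i).foldl EdgeFilter.and (f i))).congr fun i => ?_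
    simp only [EdgeFilter.SingletonSatisfiable, JointlySatisfiable, sat_foldl_and, hfl]
  -- The empty conjunction is answered directly: if there are neither patterns nor properties, no
  -- filter exists that could express it.
  · refine (const _ (.cons .nil .nil)).congr fun i => ?_
    rw [truth_of]
    have h : L i.1 = [] := by simpa using i.2
    exact ⟨[], ∅, Set.subsingleton_empty, by simp [h]⟩

theorem PolyTime.eq_of_injective {X : Type} {c : X → Data} (hc : Function.Injective c)
    {x y : I → X} (hx : PolyTime u fun i => c (x i)) (hy : PolyTime u fun i => c (y i)) :
    PolyTime u fun i => truth (x i = y i) :=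
  (eq hx hy).congr fun i => by rw [hc.eq_iff]

end

/-! ## The Horn clauses of an AUTC -/

/-- The code of a value of a tree: no state, or a single state. -/
def valueCode {QQ : Type} (cQ : QQ → Data) : Option QQ → Data
  | none => .nil
  | some q => .cons (cQ q) .nil

/-- Facts: a horizontal state is reachable, or a value of trees is. -/
def factCode {PP QQ : Type} (cP : PP → Data) (cQ : QQ → Data) : PP ⊕ Option QQ → Data
  | .inl p => .cons .nil (cP p)
  | .inr v => .cons (.cons .nil .nil) (valueCode cQ v)

/-- Forward chaining tests membership of facts by comparing their codes. -/
theorem factCode_injective {PP QQ : Type} {cP : PP → Data} {cQ : QQ → Data}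
    (hP : Function.Injective cP) (hQ : Function.Injective cQ) :
    Function.Injective (factCode cP cQ) := by
  rintro (p | _ | q) (p' | _ | q') h <;> simp [factCode, valueCode] at h ⊢
  · exact hP h
  · exact hQ h

namespace AUTC

variable {α QQ PP : Type} {Pat : Set (Pattern α)}

/-- Filters that, together, say that the states at an edge are those of `v`. -/
def guard (A : AUTC α QQ PP Pat) : Option QQ → List (EdgeFilter α QQ Pat)
  | none => A.aut.states.map fun q => .not (.prop q)
  | some q => [.prop q]

/-- The possible values of trees. -/
def values (A : AUTC α QQ PP Pat) : List (Option QQ) := none :: A.aut.states.map some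

open Classical in
/-- Filters that, together, say that no transition from `p` reads the edge. -/
noncomputable def blocked (A : AUTC α QQ PP Pat) (p : PP) : List (EdgeFilter α QQ Pat) :=
  A.horizontal.rules.flatMap fun r => if r.1 = p then [.not r.2.1] else []

open Classical in
/-- Reachability by a transition. -/
noncomputable def moveClauses (A : AUTC α QQ PP Pat) :
    List ((PP ⊕ Option QQ) × (PP ⊕ Option QQ) × (PP ⊕ Option QQ)) :=
  A.horizontal.rules.flatMap fun r => A.values.flatMap fun v =>
    if JointlySatisfiable (r.2.1 :: A.guard v) then [(.inl r.1, .inr v, .inl r.2.2)] else []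

/-- The rules, with descriptors given by pairs of horizontal states. -/
def ruleTriples (A : AUTC α QQ PP Pat) : List ((PP × PP) × QQ) :=
  A.aut.rules.map fun r => (r.1.1.1, r.2)

/-- Reachability by a rule. -/
def ruleClauses (A : AUTC α QQ PP Pat) :
    List ((PP ⊕ Option QQ) × (PP ⊕ Option QQ) × (PP ⊕ Option QQ)) :=
  A.ruleTriples.map fun r => (.inl r.1.2, .inl r.1.2, .inr (some r.2))

open Classical in
/-- Reachability of the empty value, for lack of a rule. -/
noncomputable def lackClauses (A : AUTC α QQ PP Pat) :
    List ((PP ⊕ Option QQ) × (PP ⊕ Option QQ) × (PP ⊕ Option QQ)) :=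
  A.horizontal.states.flatMap fun p =>
    if ¬ ∃ r ∈ A.ruleTriples, r.1.2 = p then [(.inl p, .inl p, .inr none)] else []

open Classical in
/-- Reachability of the empty value, by failure. -/
noncomputable def failClauses (A : AUTC α QQ PP Pat) :
    List ((PP ⊕ Option QQ) × (PP ⊕ Option QQ) × (PP ⊕ Option QQ)) :=
  A.horizontal.states.flatMap fun p => A.values.flatMap fun v =>
    if JointlySatisfiable (A.blocked p ++ A.guard v) then [(.inl p, .inr v, .inr none)] else []

/-- The Horn clauses that describe reachability. -/
noncomputable def clauses (A : AUTC α QQ PP Pat) :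
    List ((PP ⊕ Option QQ) × (PP ⊕ Option QQ) × (PP ⊕ Option QQ)) :=
  A.moveClauses ++ (A.ruleClauses ++ (A.lackClauses ++ A.failClauses))

/-- Some final state is derivable. -/
def FinalDerivable (A : AUTC α QQ PP Pat) : Prop :=
  ∃ q ∈ A.aut.final, Derivable A.clauses (.inl A.initial) (.inr (some q))

-- Polynomial-time construction of the clauses

section

variable {I : Type} {u : I → Data} (cA : Coding α) (cQ : Coding QQ) (cP : Coding PP)

/-- The code of a transition. -/
def transitionCode (r : PP × EdgeFilter α QQ Pat × PP) : Data :=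
  .cons (cP.code r.1) (.cons (r.2.1.code cA.code cQ.code) (cP.code r.2.2))

/-- The code of a rule. -/
def tripleCode (r : (PP × PP) × QQ) : Data :=
  .cons (.cons (cP.code r.1.1) (cP.code r.1.2)) (cQ.code r.2)

theorem polyTime_guard {A : I → AUTC α QQ PP Pat} {v : I → Option QQ}
    (hS : PolyTime u fun i => Coding.list cQ.code (A i).aut.states)
    (hv : PolyTime u fun i => valueCode cQ.code (v i)) :
    PolyTime u fun i => Coding.list (EdgeFilter.code cA.code cQ.code) ((A i).guard (v i)) := by
  have h0 : PolyTime u fun i => truth (v i ≠ none) :=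
    PolyTime.truth_ne hv fun i => by cases v i <;> simp [valueCode]
  have h1 := h0.ite (((PolyTime.const u (.cons .nil .nil)).pair hv.hd).pair (.const u .nil))
    (PolyTime.map (cZ := EdgeFilter.code cA.code cQ.code)
      (G := fun i q => (EdgeFilter.not (.prop q) : EdgeFilter α QQ Pat)) hS
      ((PolyTime.const _ _).pair ((PolyTime.const _ _).pair (PolyTime.refl _).tl)))
  refine h1.congr fun i => ?_
  cases h : v i <;> simp [valueCode, guard, Coding.list, Data.ofList, EdgeFilter.code, Data.hd]

theorem polyTime_values {A : I → AUTC α QQ PP Pat}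
    (hS : PolyTime u fun i => Coding.list cQ.code (A i).aut.states) :
    PolyTime u fun i => Coding.list (valueCode cQ.code) (A i).values :=
  .cons (.const u .nil) (.map (G := fun _ q => some q) hS ((PolyTime.refl _).tl.pair (.const _ _)))

theorem polyTime_blocked {A : I → AUTC α QQ PP Pat} {p : I → PP}
    (hR : PolyTime u fun i =>
      Coding.list (transitionCode cA cQ cP) (A i).horizontal.rules)
    (hp : PolyTime u fun i => cP.code (p i)) :
    PolyTime u fun i => Coding.list (EdgeFilter.code cA.code cQ.code) ((A i).blocked (p i)) := by
  classical
  refine .flatMap hR (.iteSingleton (.eq_of_injective cP.injective ?_ hp.outer) ?_)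
  · exact (PolyTime.refl _).tl.hd
  · exact (PolyTime.const _ _).pair (PolyTime.refl _).tl.tl.hd

/-- The coding of AUTCs. -/
abbrev encode (A : AUTC α QQ PP Pat) : Data := A.code cA.code cQ.code cP.code

theorem polyTime_horizontal_states :
    PolyTime (encode (Pat := Pat) cA cQ cP) fun A => Coding.list cP.code A.horizontal.states :=
  (PolyTime.refl _).hd.hd

theorem polyTime_horizontal_rules :
    PolyTime (encode (Pat := Pat) cA cQ cP) fun A =>
      Coding.list (transitionCode cA cQ cP) A.horizontal.rules :=
  (PolyTime.refl _).hd.tl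

theorem polyTime_states :
    PolyTime (encode (Pat := Pat) cA cQ cP) fun A => Coding.list cQ.code A.aut.states :=
  (PolyTime.refl _).tl.tl.hd

theorem polyTime_final :
    PolyTime (encode (Pat := Pat) cA cQ cP) fun A => Coding.list cQ.code A.aut.final :=
  (PolyTime.refl _).tl.tl.tl.hd

/-- The type of descriptors varies with the automaton, whereas the list combinators need one element
type for all instances. Triples provide it, and their codes are literally those of the rules. -/
theorem polyTime_ruleTriples :
    PolyTime (encode (Pat := Pat) cA cQ cP) fun A =>
      Coding.list (tripleCode cQ cP) A.ruleTriples :=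
  (PolyTime.refl (encode cA cQ cP)).tl.tl.tl.tl.congr fun A => by
    simp only [Coding.list, ruleTriples, List.map_map]
    rfl

theorem polyTime_moveClauses
    (hsat : PolyTime (fun f : EdgeFilter α QQ Pat => f.code cA.code cQ.code)
      fun f => truth f.SingletonSatisfiable) :
    PolyTime (encode (Pat := Pat) cA cQ cP) fun A =>
      Coding.list (clauseCode (factCode cP.code cQ.code)) A.moveClauses := by
  classical
  refine .flatMap (polyTime_horizontal_rules cA cQ cP)
    (.flatMap (polyTime_values cQ (polyTime_states cA cQ cP).outer)
      (.iteSingleton (.jointlySatisfiable hsat (.cons ?_ (polyTime_guard cA cQ ?_ ?_))) ?_))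
  · exact (PolyTime.refl _).hd.tl.tl.hd
  · exact ((polyTime_states cA cQ cP).outer (w := fun j => transitionCode cA cQ cP j.2)).outer
  · exact (PolyTime.refl _).tl
  · exact ((PolyTime.const _ _).pair (PolyTime.refl _).hd.tl.hd).pair
      (((PolyTime.const _ _).pair (PolyTime.refl _).tl).pair
        ((PolyTime.const _ _).pair (PolyTime.refl _).hd.tl.tl.tl))

theorem polyTime_ruleClauses :
    PolyTime (encode (Pat := Pat) cA cQ cP) fun A =>
      Coding.list (clauseCode (factCode cP.code cQ.code)) A.ruleClauses := by
  refine .map (polyTime_ruleTriples cA cQ cP) ?_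
  exact ((PolyTime.const _ _).pair (PolyTime.refl _).tl.hd.tl).pair
    (((PolyTime.const _ _).pair (PolyTime.refl _).tl.hd.tl).pair
      ((PolyTime.const _ _).pair ((PolyTime.refl _).tl.tl.pair (.const _ _))))

theorem polyTime_lackClauses :
    PolyTime (encode (Pat := Pat) cA cQ cP) fun A =>
      Coding.list (clauseCode (factCode cP.code cQ.code)) A.lackClauses := by
  classical
  refine .flatMap (polyTime_horizontal_states cA cQ cP) (.iteSingleton
    (.not (.exists_mem (polyTime_ruleTriples cA cQ cP).outer
      (.eq_of_injective cP.injective ?_ ?_))) ?_)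
  · exact (PolyTime.refl _).tl.hd.tl
  · exact (PolyTime.refl _).hd.tl
  · exact ((PolyTime.const _ _).pair (PolyTime.refl _).tl).pair
      (((PolyTime.const _ _).pair (PolyTime.refl _).tl).pair (.const _ _))

theorem polyTime_failClauses
    (hsat : PolyTime (fun f : EdgeFilter α QQ Pat => f.code cA.code cQ.code)
      fun f => truth f.SingletonSatisfiable) :
    PolyTime (encode (Pat := Pat) cA cQ cP) fun A =>
      Coding.list (clauseCode (factCode cP.code cQ.code)) A.failClauses := by
  classical
  refine .flatMap (polyTime_horizontal_states cA cQ cP)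
    (.flatMap (polyTime_values cQ (polyTime_states cA cQ cP).outer)
      (.iteSingleton (.jointlySatisfiable hsat (.append
        (polyTime_blocked cA cQ cP ((polyTime_horizontal_rules cA cQ cP).outer
          (w := fun j => cP.code j.2)).outer ?_)
        (polyTime_guard cA cQ ?_ ?_))) ?_))
  · exact (PolyTime.refl _).hd.tl
  · exact ((polyTime_states cA cQ cP).outer (w := fun j => cP.code j.2)).outer
  · exact (PolyTime.refl _).tl
  · exact ((PolyTime.const _ _).pair (PolyTime.refl _).hd.tl).pair
      (((PolyTime.const _ _).pair (PolyTime.refl _).tl).pair (.const _ _))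

theorem polyTime_finalDerivable
    (hsat : PolyTime (fun f : EdgeFilter α QQ Pat => f.code cA.code cQ.code)
      fun f => truth f.SingletonSatisfiable) :
    PolyTime (encode (Pat := Pat) cA cQ cP) fun A => truth A.FinalDerivable := by
  have hC : PolyTime (encode (Pat := Pat) cA cQ cP) fun A =>
      Coding.list (clauseCode (factCode cP.code cQ.code)) A.clauses :=
    (polyTime_moveClauses cA cQ cP hsat).append ((polyTime_ruleClauses cA cQ cP).append
      ((polyTime_lackClauses cA cQ cP).append (polyTime_failClauses cA cQ cP hsat)))
  have hc := factCode_injective cP.injective cQ.injective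
  have hH := PolyTime.horn (a := fun A => .inl A.initial) hc hC
    ((PolyTime.const _ _).pair (PolyTime.refl _).tl.hd)
  refine (PolyTime.exists_mem
    (P := fun A q => .inr (some q) ∈ horn A.clauses (.inl A.initial)) (polyTime_final cA cQ cP) (.mem (x := fun j => .inr (some j.2))
    hc ?_ hH.outer)).congr fun A => ?_
  · exact (PolyTime.const _ _).pair ((PolyTime.refl _).tl.pair (.const _ _))
  · simp only [mem_horn, FinalDerivable]

end

end AUTC

/-! ## Supports -/

namespace HorizontalClass

variable {α QQ : Type} {D : HorizontalClass α QQ} {h : D.Desc}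

theorem DependsOnlyOn.mono {Q Q' : Set QQ} (hQ : DependsOnlyOn D h Q) (hQQ : Q ⊆ Q') :
    DependsOnlyOn D h Q' := fun l hl => hQ l fun x hx => by
  rw [← Set.inter_eq_self_of_subset_right hQQ, ← Set.inter_assoc, hl x hx, Set.inter_assoc]

theorem DependsOnlyOn.inter {Q Q' : Set QQ} (hQ : DependsOnlyOn D h Q)
    (hQ' : DependsOnlyOn D h Q') : DependsOnlyOn D h (Q ∩ Q') := by
  intro l hl
  -- The interpolant equals the first set inside `Q` and the second outside. It agrees with the
  -- first on `Q`, and with the second on `Q'`, because the two sets agree on `Q ∩ Q'`.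
  let mid : List α × Set QQ × Set QQ → Set QQ := fun x => x.2.1 ∩ Q ∪ x.2.2 ∩ Qᶜ
  have h1 := hQ (l.map fun x => (x.1, x.2.1, mid x)) fun y hy => by
    obtain ⟨x, -, rfl⟩ := List.mem_map.1 hy
    ext q
    simp only [mid, Set.mem_inter_iff, Set.mem_union, Set.mem_compl_iff]
    tauto
  have h2 := hQ' (l.map fun x => (x.1, mid x, x.2.2)) fun y hy => by
    obtain ⟨x, hx, rfl⟩ := List.mem_map.1 hy
    ext q
    have := Set.ext_iff.1 (hl x hx) q
    simp only [mid, Set.mem_inter_iff, Set.mem_union, Set.mem_compl_iff] at this ⊢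
    tauto
  simp only [List.map_map] at h1 h2
  exact h1.trans h2

/-- A descriptor that depends on finitely many properties depends on its support only. -/
theorem dependsOnlyOn_support (F : Finset QQ) (hF : DependsOnlyOn D h F) :
    DependsOnlyOn D h (support D h) := by
  classical
  -- A minimal finite `Q` lies inside every `Q'` that `h` depends on, since otherwise `Q ∩ Q'` would
  -- be smaller. Hence it lies inside the support.
  obtain ⟨Q, hQ, hmin⟩ := WellFounded.has_min (wellFounded_lt (α := Finset QQ))
    {Q : Finset QQ | DependsOnlyOn D h (Q : Set QQ)} ⟨F, hF⟩
  refine DependsOnlyOn.mono hQ fun q hq => Set.mem_sInter.2 fun Q' hQ' => ?_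
  by_contra hne
  refine hmin (Q.filter (· ∈ Q')) ?_ (Finset.filter_ssubset.2 ⟨q, hq, hne⟩)
  have := DependsOnlyOn.inter hQ hQ'
  simpa [Set.inter_def] using this

end HorizontalClass

/-- The properties that occur in a filter. -/
def EdgeFilter.props {α QQ : Type} {Pat : Set (Pattern α)} : EdgeFilter α QQ Pat → List QQ
  | .pat _ => []
  | .prop q => [q]
  | .and f g => f.props ++ g.props
  | .not f => f.props

theorem EdgeFilter.sat_congr {α QQ : Type} {Pat : Set (Pattern α)} (f : EdgeFilter α QQ Pat)
    (d : List α) {Q Q' : Set QQ} (h : ∀ q ∈ f.props, q ∈ Q ↔ q ∈ Q') :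
    f.Sat (d, Q) ↔ f.Sat (d, Q') := by
  induction f with
  | pat _ => rfl
  | prop q => exact h q (by simp [props])
  | and f g hf hg =>
    exact and_congr (hf fun q hq => h q (by simp [props, hq]))
      (hg fun q hq => h q (by simp [props, hq]))
  | not f hf => exact not_congr (hf h)

-- Properties relevant to a horizontal automaton

namespace HorizontalAutomaton

open Relation

variable {α QQ PP : Type} {Pat : Set (Pattern α)} (H : HorizontalAutomaton α QQ PP Pat)

/-- The properties that occur in the transitions. -/
def props : List QQ := H.rules.flatMap fun r => r.2.1.props

/-- The same transitions can be taken on both annotations, as their filters see only properties in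
`H.props`. A multiset of triples keeps the two annotations of each edge matched. -/
theorem reads_congr {p p' : PP} {N : Multiset (List α × Set QQ × Set QQ)}
    (hN : ∀ x ∈ N, ∀ q ∈ H.props, q ∈ x.2.1 ↔ q ∈ x.2.2)
    (h : ReflTransGen H.Rew (p, N.map fun x => (x.1, x.2.1)) (p', 0)) :
    ReflTransGen H.Rew (p, N.map fun x => (x.1, x.2.2)) (p', 0) := by
  classical
  generalize ha : (p, N.map fun x => (x.1, x.2.1)) = a at h
  generalize hb : (p', (0 : Multiset (List α × Set QQ))) = b at h
  induction h using ReflTransGen.head_induction_on generalizing p N with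
  | refl =>
    subst hb
    obtain ⟨rfl, h0⟩ := Prod.mk.inj ha
    obtain rfl := Multiset.map_eq_zero.1 h0
    exact .refl
  | @head a c hac _ ih =>
    subst ha
    obtain ⟨x, f, hx, hf, hs⟩ := hac
    have hx' : x ∈ N.map fun x => (x.1, x.2.1) := by rw [show N.map _ = _ from hx]; simp
    obtain ⟨y, hy, rfl⟩ := Multiset.mem_map.1 hx'
    obtain ⟨N', rfl⟩ := Multiset.exists_cons_of_mem hy
    have hN' : N'.map (fun x => (x.1, x.2.1)) = c.2 := by
      simpa using hx
    rw [Multiset.map_cons]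
    refine .head ?_ (ih (p := c.1) (N := N') (fun x hx => hN x (Multiset.mem_cons_of_mem hx))
      (by rw [hN']))
    refine ⟨_, f, rfl, hf, (f.sat_congr _ fun q hq => ?_).1 hs⟩
    exact hN y hy q (List.mem_flatMap.2 ⟨_, hf, hq⟩)

theorem dependsOnlyOn_props (p₀ : PP) (h : (H.confClass p₀).Desc) :
    HorizontalClass.DependsOnlyOn (H.confClass p₀) h {q | q ∈ H.props} := by
  intro l hl
  have hl' : ∀ x ∈ l, ∀ q ∈ H.props, q ∈ x.2.1 ↔ q ∈ x.2.2 := fun x hx q hq => by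
    have := Set.ext_iff.1 (hl x hx) q
    simpa [hq] using this
  constructor
  · intro h1
    have h2 : ReflTransGen H.Rew
        (h.1.1.1, (l : Multiset (List α × Set QQ × Set QQ)).map fun x => (x.1, x.2.1))
        (h.1.1.2, 0) := h1
    exact H.reads_congr hl' h2
  · intro h1
    have := H.reads_congr (p := h.1.1.1) (p' := h.1.1.2)
      (N := ((l.map fun x => (x.1, x.2.2, x.2.1) : List _) : Multiset _)) (fun x hx q hq => by
        obtain ⟨y, hy, rfl⟩ := List.mem_map.1 (Multiset.mem_coe.1 hx)
        exact (hl' y hy q hq).symm) (by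
        rw [Multiset.map_coe, List.map_map]
        exact h1)
    rw [Multiset.map_coe, List.map_map] at this
    exact this

theorem dependsOnlyOn_support (p₀ : PP) (h : (H.confClass p₀).Desc) :
    HorizontalClass.DependsOnlyOn (H.confClass p₀) h
      (HorizontalClass.support (H.confClass p₀) h) := by
  classical
  exact HorizontalClass.dependsOnlyOn_support H.props.toFinset
    ((H.dependsOnlyOn_props p₀ h).mono fun q hq => by simpa using hq)

/-! ## Runs of horizontal automata -/

variable {H}

theorem Rew.add {a b : PP × Multiset (List α × Set QQ)} (h : H.Rew a b)
    (N : Multiset (List α × Set QQ)) : H.Rew (a.1, a.2 + N) (b.1, b.2 + N) := by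
  obtain ⟨x, f, hx, hf, hs⟩ := h
  exact ⟨x, f, by simp [hx], hf, hs⟩

/-- Edges have no order, so a new edge can be left to the end of a given run. -/
theorem reads_cons {p p' : PP} {M : Multiset (List α × Set QQ)}
    (h : ReflTransGen H.Rew (p, M) (p', 0)) (x : List α × Set QQ) :
    ReflTransGen H.Rew (p, x ::ₘ M) (p', {x}) := by
  have : ReflTransGen H.Rew (p, M + {x}) (p', 0 + {x}) :=
    h.lift (fun a => (a.1, a.2 + {x})) fun a b hab => hab.add {x}
  simpa [Multiset.add_comm M, Multiset.singleton_add] using this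

theorem failRew_of_rew {a b : PP × Multiset (List α × Set QQ)} (h : ReflTransGen H.Rew a b) :
    ReflTransGen H.FailRew (some a) (some b) :=
  h.lift some fun _ _ => .rew

theorem eq_of_failRew_zero {p : PP} {d : Option (PP × Multiset (List α × Set QQ))}
    (h : ReflTransGen H.FailRew (some (p, 0)) d) : d = some (p, 0) := by
  rcases ReflTransGen.cases_head h with h | ⟨c, h, -⟩
  · exact h.symm
  · cases h with
    | rew h => obtain ⟨x, f, hx, -⟩ := h; simp at hx
    | fail h => exact absurd rfl h

theorem eq_of_failRew_none {d : Option (PP × Multiset (List α × Set QQ))}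
    (h : ReflTransGen H.FailRew none d) : d = none := by
  rcases ReflTransGen.cases_head h with h | ⟨c, h, -⟩
  · exact h.symm
  · cases h

/-- Configurations without edges are normal forms even for the failure-extended relation, so two
joinable ones coincide. -/
theorem Confluent.reads_unique (hH : H.Confluent) {a : PP × Multiset (List α × Set QQ)}
    {p p' : PP} (h : ReflTransGen H.Rew a (p, 0)) (h' : ReflTransGen H.Rew a (p', 0)) :
    p = p' := by
  obtain ⟨d, h1, h2⟩ := hH _ _ _ (failRew_of_rew h) (failRew_of_rew h')
  have h3 := (eq_of_failRew_zero h1).symm.trans (eq_of_failRew_zero h2)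
  simpa using h3

/-- A stuck configuration rewrites to `⊥`, which cannot be joined with a completed run, both being
normal forms. -/
theorem Confluent.not_reads (hH : H.Confluent) {a b : PP × Multiset (List α × Set QQ)} {p : PP}
    (h : ReflTransGen H.Rew a b) (hb : b.2 ≠ 0) (hs : ¬ ∃ c, H.Rew b c) :
    ¬ ReflTransGen H.Rew a (p, 0) := by
  intro h'
  obtain ⟨d, h1, h2⟩ := hH _ _ _ ((failRew_of_rew h).tail (.fail hb hs)) (failRew_of_rew h')
  have h3 := (eq_of_failRew_none h1).symm.trans (eq_of_failRew_zero h2)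
  simp at h3

theorem exists_normal_form (a : PP × Multiset (List α × Set QQ)) :
    ∃ b, ReflTransGen H.Rew a b ∧ ¬ ∃ c, H.Rew b c := by
  generalize hn : a.2.card = n
  induction n generalizing a with
  | zero =>
    refine ⟨a, .refl, ?_⟩
    rintro ⟨c, x, f, hx, -⟩
    simp [hx] at hn
  | succ n ih =>
    by_cases h : ∃ c, H.Rew a c
    · obtain ⟨c, hc⟩ := h
      have hc' : c.2.card = n := by
        obtain ⟨x, f, hx, -⟩ := hc
        simpa [hx] using hn
      obtain ⟨b, h1, h2⟩ := ih c hc'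
      exact ⟨b, .head hc h1, h2⟩
    · exact ⟨a, .refl, h⟩

end HorizontalAutomaton

/-! ## Correctness of the Horn clauses -/

namespace AUTC

open Relation

variable {α QQ PP : Type} {Pat : Set (Pattern α)} (A : AUTC α QQ PP Pat)

/-- From the initial state, `M` can be read so that the state `p` is reached. -/
def Reads (M : Multiset (List α × Set QQ)) (p : PP) : Prop :=
  ReflTransGen A.horizontal.Rew (A.initial, M) (p, 0)

/-- The set of states of a value. -/
def valueSet (v : Option QQ) : Set QQ := {q | v = some q}

theorem subsingleton_valueSet (v : Option QQ) : (valueSet v).Subsingleton := fun _ hq _ hq' =>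
  Option.some_injective _ ((Eq.symm hq).trans hq')

theorem sat_desc_iff (M : Multiset (List α × Set QQ))
    (h : (A.horizontal.confClass A.initial).Desc) :
    (A.horizontal.confClass A.initial).Sat M h ↔ A.Reads M h.1.1.2 := by
  have h0 : h.1.1.1 = A.initial := h.2
  change ReflTransGen A.horizontal.Rew (h.1.1.1, M) (h.1.1.2, 0) ↔ _
  rw [h0, Reads]

theorem mem_step {M : Multiset (List α × Set QQ)} {q : QQ} :
    q ∈ A.aut.step M ↔ ∃ r ∈ A.ruleTriples, r.2 = q ∧ A.Reads M r.1.2 := by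
  constructor
  · rintro ⟨h, hr, hs⟩
    exact ⟨_, List.mem_map.2 ⟨_, hr, rfl⟩, rfl, (A.sat_desc_iff M h).1 hs⟩
  · rintro ⟨r, hr, rfl, hs⟩
    obtain ⟨⟨h, q⟩, hr', rfl⟩ := List.mem_map.1 hr
    exact ⟨h, hr', (A.sat_desc_iff M h).2 hs⟩

theorem mem_states_of_mem_eval {t : Tree α} {q : QQ} (h : q ∈ A.aut.eval t) :
    q ∈ A.aut.states := by
  rw [AUT.eval_eq] at h
  obtain ⟨h, hr, -⟩ := h
  exact A.aut.rules_target _ hr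

/-- Edges with trees and with sets of properties that agree, on the states, with the values of
the trees. -/
def Annotated (l : List (List α × Tree α × Set QQ)) : Prop :=
  ∀ x ∈ l, x.2.2 ∩ {q | q ∈ A.aut.states} = A.aut.eval x.2.1

/-- The edges with the sets of properties. -/
def edges (l : List (List α × Tree α × Set QQ)) : Multiset (List α × Set QQ) :=
  (l.map fun x => (x.1, x.2.2) : List (List α × Set QQ))

/-- The tree with the given edges. -/
def tree (l : List (List α × Tree α × Set QQ)) : Tree α :=
  Tree.node (l.map fun x => (x.1, x.2.1) : List (List α × Tree α))

/-- The sets in `l` may differ from the values of the subtrees outside the states. Each rule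
descriptor depends only on its support, which consists of states, so either annotation yields the
same satisfied rules. -/
theorem mem_eval_tree {l : List (List α × Tree α × Set QQ)} (hl : A.Annotated l) {q : QQ} :
    q ∈ A.aut.eval (tree l) ↔ ∃ r ∈ A.ruleTriples, r.2 = q ∧ A.Reads (edges l) r.1.2 := by
  rw [AUT.eval_eq, tree, Tree.children_node, Multiset.map_coe, List.map_map, mem_step]
  refine exists_congr fun r => and_congr_right fun hr => and_congr_right fun _ => ?_
  obtain ⟨⟨h, q'⟩, hr', rfl⟩ := List.mem_map.1 hr
  have h1 := (A.horizontal.dependsOnlyOn_support A.initial h).mono (A.aut.rules_support _ hr')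
    (l.map fun x => (x.1, A.aut.eval x.2.1, x.2.2)) fun y hy => by
      obtain ⟨x, hx, rfl⟩ := List.mem_map.1 hy
      refine (Set.inter_eq_left.2 fun q hq => ?_).trans (hl x hx).symm
      exact A.mem_states_of_mem_eval hq
  rw [List.map_map, List.map_map, sat_desc_iff, sat_desc_iff] at h1
  exact h1

theorem eval_eq_of_mem {t : Tree α} {q : QQ} (h : q ∈ A.aut.eval t) :
    A.aut.eval t = valueSet (some q) := by
  ext q'
  refine ⟨fun h' => congrArg some (A.deterministic t h h'), fun h' => ?_⟩
  obtain rfl : q = q' := Option.some_injective _ h'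
  exact h

/-- For `some q`, subsingletonness forces `Q = {q}`. For `none`, the guard excludes only states, so
`Q` may still contain another property. -/
theorem inter_states_of_guard {v : Option QQ} {t : Tree α} (ht : A.aut.eval t = valueSet v)
    {d : List α} {Q : Set QQ} (hQ : Q.Subsingleton) (h : ∀ f ∈ A.guard v, f.Sat (d, Q)) :
    Q ∩ {q | q ∈ A.aut.states} = A.aut.eval t := by
  cases v with
  | none =>
    have h0 : A.aut.eval t = ∅ := by rw [ht]; ext q; simp [valueSet]
    rw [h0, ← Set.disjoint_iff_inter_eq_empty, Set.disjoint_left]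
    intro q hq hS
    exact h _ (List.mem_map.2 ⟨q, hS, rfl⟩) hq
  | some q =>
    have hq : q ∈ Q := h (.prop q) (List.mem_singleton.2 rfl)
    have hS : q ∈ A.aut.states := A.mem_states_of_mem_eval (t := t) (by rw [ht]; rfl)
    rw [ht]
    ext q'
    simp only [valueSet, Set.mem_inter_iff, Set.mem_ofPred_eq, Option.some.injEq]
    exact ⟨fun h' => hQ hq h'.1, by rintro rfl; exact ⟨hq, hS⟩⟩

theorem sat_guard (v : Option QQ) (d : List α) :
    ∀ f ∈ A.guard v, f.Sat (d, valueSet v) := by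
  intro f hf
  cases v with
  | none =>
    obtain ⟨q, -, rfl⟩ := List.mem_map.1 hf
    exact fun h => nomatch (show none = some q from h)
  | some q =>
    obtain rfl := List.mem_singleton.1 hf
    exact (rfl : some q = some q)

theorem sat_blocked {p : PP} {x : List α × Set QQ} :
    (∀ f ∈ A.blocked p, f.Sat x) ↔ ∀ f p', (p, f, p') ∈ A.horizontal.rules → ¬ f.Sat x := by
  classical
  simp only [blocked, List.mem_flatMap]
  constructor
  · exact fun h f p' hr => h (.not f) ⟨_, hr, by simp⟩
  · rintro h f ⟨⟨p', g, p''⟩, hr, hf⟩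
    by_cases hp : p' = p
    · subst hp
      obtain rfl : f = .not g := by simpa using hf
      exact h g p'' hr
    · simp [hp] at hf

theorem mem_values {v : Option QQ} (h : ∀ q, v = some q → q ∈ A.aut.states) : v ∈ A.values := by
  cases v with
  | none => exact List.mem_cons_self
  | some q => exact List.mem_cons_of_mem _ (List.mem_map.2 ⟨q, h q rfl, rfl⟩)

/-! ### Soundness -/

/-- The meaning of facts. -/
def Valid : PP ⊕ Option QQ → Prop
  | .inl p => ∃ l, A.Annotated l ∧ A.Reads (edges l) p
  | .inr v => ∃ t, A.aut.eval t = valueSet v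

theorem eval_eq_none {t : Tree α} (h : ∀ q, q ∉ A.aut.eval t) :
    A.aut.eval t = valueSet none := by
  ext q
  exact ⟨fun h' => absurd h' (h q), fun h' => nomatch (show none = some q from h')⟩

theorem valid_move {x y z : PP ⊕ Option QQ} (hc : (x, y, z) ∈ A.moveClauses) (hx : A.Valid x)
    (hy : A.Valid y) : A.Valid z := by
  classical
  simp only [moveClauses, List.mem_flatMap] at hc
  obtain ⟨⟨p, f, p'⟩, hr, v, -, hc⟩ := hc
  split at hc
  case isFalse => simp at hc
  rename_i hs
  obtain ⟨rfl, rfl, rfl⟩ : x = .inl p ∧ y = .inr v ∧ z = .inl p' := by simpa using hc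
  obtain ⟨d, Q, hQ, hs⟩ := hs
  obtain ⟨l, hl, hp⟩ := hx
  obtain ⟨t, ht⟩ := hy
  refine ⟨(d, t, Q) :: l, ?_, ?_⟩
  · rintro x hx
    rcases List.mem_cons.1 hx with rfl | hx
    · exact A.inter_states_of_guard ht hQ fun g hg => hs g (List.mem_cons_of_mem _ hg)
    · exact hl x hx
  · refine (HorizontalAutomaton.reads_cons hp (d, Q)).tail ?_
    exact ⟨(d, Q), f, rfl, hr, hs f List.mem_cons_self⟩

theorem valid_rule {x y z : PP ⊕ Option QQ} (hc : (x, y, z) ∈ A.ruleClauses) (hx : A.Valid x) :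
    A.Valid z := by
  obtain ⟨r, hr, hc⟩ := List.mem_map.1 hc
  obtain ⟨rfl, rfl, rfl⟩ : .inl r.1.2 = x ∧ .inl r.1.2 = y ∧ .inr (some r.2) = z := by
    simpa using hc
  obtain ⟨l, hl, hp⟩ := hx
  exact ⟨tree l, A.eval_eq_of_mem ((A.mem_eval_tree hl).2 ⟨r, hr, rfl, hp⟩)⟩

/-- A rule that fires would come with a completed run; by confluence that run ends in `p`, for which
there is no rule. -/
theorem valid_lack {x y z : PP ⊕ Option QQ} (hc : (x, y, z) ∈ A.lackClauses) (hx : A.Valid x) :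
    A.Valid z := by
  classical
  simp only [lackClauses, List.mem_flatMap] at hc
  obtain ⟨p, -, hc⟩ := hc
  split at hc
  case isFalse => simp at hc
  rename_i hs
  obtain ⟨rfl, rfl, rfl⟩ : x = .inl p ∧ y = .inl p ∧ z = .inr none := by simpa using hc
  obtain ⟨l, hl, hp⟩ := hx
  refine ⟨tree l, A.eval_eq_none fun q hq => ?_⟩
  obtain ⟨r, hr, -, hp'⟩ := (A.mem_eval_tree hl).1 hq
  exact hs ⟨r, hr, A.confluent.reads_unique hp' hp⟩

/-- Reading the other edges first leaves the blocked edge alone in state `p`. This run is stuck, so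
by confluence no run completes and no rule fires. -/
theorem valid_fail {x y z : PP ⊕ Option QQ} (hc : (x, y, z) ∈ A.failClauses) (hx : A.Valid x)
    (hy : A.Valid y) : A.Valid z := by
  classical
  simp only [failClauses, List.mem_flatMap] at hc
  obtain ⟨p, -, v, -, hc⟩ := hc
  split at hc
  case isFalse => simp at hc
  rename_i hs
  obtain ⟨rfl, rfl, rfl⟩ : x = .inl p ∧ y = .inr v ∧ z = .inr none := by simpa using hc
  obtain ⟨d, Q, hQ, hs⟩ := hs
  obtain ⟨l, hl, hp⟩ := hx
  obtain ⟨t, ht⟩ := hy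
  have hl' : A.Annotated ((d, t, Q) :: l) := by
    rintro x hx
    rcases List.mem_cons.1 hx with rfl | hx
    · exact A.inter_states_of_guard ht hQ fun g hg => hs g (List.mem_append_right _ hg)
    · exact hl x hx
  refine ⟨tree ((d, t, Q) :: l), A.eval_eq_none fun q hq => ?_⟩
  obtain ⟨r, hr, -, hp'⟩ := (A.mem_eval_tree hl').1 hq
  refine A.confluent.not_reads (HorizontalAutomaton.reads_cons hp (d, Q))
    (Multiset.singleton_ne_zero _) ?_ hp'
  rintro ⟨b, x, f, hx, hf, hsat⟩
  have hx' : x ∈ ({(d, Q)} : Multiset (List α × Set QQ)) := by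
    rw [show ({(d, Q)} : Multiset _) = _ from hx]
    exact Multiset.mem_cons_self _ _
  obtain rfl := Multiset.mem_singleton.1 hx'
  exact A.sat_blocked.1 (fun g hg => hs g (List.mem_append_left _ hg)) f b.1 hf hsat

theorem valid_of_derivable {x : PP ⊕ Option QQ}
    (h : Derivable A.clauses (.inl A.initial) x) : A.Valid x := by
  induction h with
  | init => exact ⟨[], fun x hx => absurd hx List.not_mem_nil, .refl⟩
  | step hc _ _ hx hy =>
    simp only [clauses, List.mem_append] at hc
    rcases hc with hc | hc | hc | hc
    · exact A.valid_move hc hx hy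
    · exact A.valid_rule hc hx
    · exact A.valid_lack hc hx
    · exact A.valid_fail hc hx hy

/-! ### Completeness -/

/-- `Q` is the set of states of a derivable value. -/
def DerivableValue (Q : Set QQ) : Prop :=
  ∃ v, Q = valueSet v ∧ v ∈ A.values ∧ Derivable A.clauses (.inl A.initial) (.inr v)

/-- Every transition of an actual run is matched by a move clause, with the value of the edge itself
as witness for joint satisfiability. -/
theorem derivable_of_rew {M : Multiset (List α × Set QQ)} (hM : ∀ x ∈ M, A.DerivableValue x.2)
    {b : PP × Multiset (List α × Set QQ)}
    (h : ReflTransGen A.horizontal.Rew (A.initial, M) b) :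
    b.1 ∈ A.horizontal.states ∧ Derivable A.clauses (.inl A.initial) (.inl b.1) ∧
      ∀ x ∈ b.2, A.DerivableValue x.2 := by
  classical
  induction h with
  | refl => exact ⟨A.initial_mem, .init, hM⟩
  | @tail b c _ hbc ih =>
    obtain ⟨-, ihp, ihM⟩ := ih
    obtain ⟨⟨d, Q⟩, f, hx, hf, hs⟩ := hbc
    rw [hx] at ihM
    refine ⟨(A.horizontal.rules_mem _ hf).2, ?_, fun y hy => ihM y (Multiset.mem_cons_of_mem hy)⟩
    obtain ⟨v, rfl, hv, hd⟩ := ihM _ (Multiset.mem_cons_self _ _)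
    refine .step (List.mem_append_left _ ?_) ihp hd
    refine List.mem_flatMap.2 ⟨_, hf, List.mem_flatMap.2 ⟨v, hv, ?_⟩⟩
    rw [if_pos]
    · exact List.mem_singleton.2 rfl
    · refine ⟨d, valueSet v, subsingleton_valueSet v, fun g hg => ?_⟩
      rcases List.mem_cons.1 hg with rfl | hg
      · exact hs
      · exact A.sat_guard v d g hg

/-- If a state is assigned, the run behind its rule derives it. Otherwise any maximal run explains
the empty value: it ends without edges in a state that has no rule, or it leaves an edge that blocks
it. Confluence is not needed here. -/
theorem derivable_step {M : Multiset (List α × Set QQ)} (hM : ∀ x ∈ M, A.DerivableValue x.2)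
    (hdet : (A.aut.step M).Subsingleton) : A.DerivableValue (A.aut.step M) := by
  classical
  rcases Set.eq_empty_or_nonempty (A.aut.step M) with h0 | ⟨q, hq⟩
  · refine ⟨none, ?_, A.mem_values (fun q hq => by simp at hq), ?_⟩
    · rw [h0]
      ext q
      simp [valueSet]
    obtain ⟨⟨p, M'⟩, hb, hn⟩ := HorizontalAutomaton.exists_normal_form
      (H := A.horizontal) (A.initial, M)
    obtain ⟨hp, hd, hM'⟩ := A.derivable_of_rew hM hb
    rcases Multiset.empty_or_exists_mem M' with rfl | ⟨⟨d, Q⟩, hx⟩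
    · refine .step (List.mem_append_right _ (List.mem_append_right _
        (List.mem_append_left _ ?_))) hd hd
      refine List.mem_flatMap.2 ⟨p, hp, ?_⟩
      rw [if_pos]
      · exact List.mem_singleton.2 rfl
      · rintro ⟨r, hr, rfl⟩
        exact (h0 ▸ A.mem_step.2 ⟨r, hr, rfl, hb⟩ : r.2 ∈ (∅ : Set QQ))
    -- No remaining edge can be read in `p`, so an arbitrary one serves as the blocked edge of a
    -- fail clause.
    · obtain ⟨v, rfl, hv, hdv⟩ := hM' _ hx
      refine .step (List.mem_append_right _ (List.mem_append_right _
        (List.mem_append_right _ ?_))) hd hdv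
      refine List.mem_flatMap.2 ⟨p, hp, List.mem_flatMap.2 ⟨v, hv, ?_⟩⟩
      rw [if_pos]
      · exact List.mem_singleton.2 rfl
      · refine ⟨d, valueSet v, subsingleton_valueSet v, fun g hg => ?_⟩
        rcases List.mem_append.1 hg with hg | hg
        · refine A.sat_blocked.2 (fun f p' hf hs => hn ?_) g hg
          obtain ⟨M'', rfl⟩ := Multiset.exists_cons_of_mem hx
          exact ⟨(p', M''), _, f, rfl, hf, hs⟩
        · exact A.sat_guard v d g hg
  · obtain ⟨r, hr, rfl, hp⟩ := A.mem_step.1 hq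
    refine ⟨some r.2, ?_, A.mem_values fun q h => ?_, ?_⟩
    · ext q'
      refine ⟨fun h' => congrArg some (hdet hq h'), fun h' => ?_⟩
      obtain rfl : r.2 = q' := Option.some_injective _ h'
      exact hq
    · obtain rfl : r.2 = q := Option.some_injective _ h
      obtain ⟨h, hr, -⟩ := hq
      exact A.aut.rules_target _ hr
    · have hd := (A.derivable_of_rew hM hp).2.1
      exact .step (List.mem_append_right _ (List.mem_append_left _
        (List.mem_map.2 ⟨r, hr, rfl⟩))) hd hd

/-- Induction on an ordered representative. Determinism is applied to the unordered class of the
subtree, whose value unfolds to the step of its annotation. -/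
theorem derivable_annotate (s : PreTree α) : ∀ x ∈ A.aut.annotate s, A.DerivableValue x.2 := by
  induction s with
  | nil => exact fun x hx => absurd hx (Multiset.notMem_zero x)
  | cons d t r iht ihr =>
    intro x hx
    rcases Multiset.mem_cons.1 hx with rfl | hx
    · exact A.derivable_step iht (A.deterministic (Quotient.mk _ t))
    · exact ihr x hx

theorem derivable_eval (t : Tree α) : A.DerivableValue (A.aut.eval t) := by
  induction t using Quotient.ind with
  | _ s => exact A.derivable_step (A.derivable_annotate s) (A.deterministic (Quotient.mk _ s))

theorem language_eq_empty_iff : A.language = ∅ ↔ ¬ A.FinalDerivable := by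
  rw [← not_iff_not, not_not, ← ne_eq, ← Set.nonempty_iff_ne_empty]
  constructor
  · rintro ⟨t, q, hq, hf⟩
    obtain ⟨v, hv, -, hd⟩ := A.derivable_eval t
    rw [hv] at hq
    obtain rfl : v = some q := hq
    exact ⟨q, hf, hd⟩
  · rintro ⟨q, hf, hd⟩
    obtain ⟨t, ht⟩ := A.valid_of_derivable hd
    exact ⟨t, q, by rw [ht]; rfl, hf⟩

end AUTC
end UnorderedTrees

theorem mainTheorem2 {α QQ PP : Type} [Finite α]
    (cA : UnorderedTrees.Coding α) (cQ : UnorderedTrees.Coding QQ)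
    (cP : UnorderedTrees.Coding PP) (Pat : Set (UnorderedTrees.Pattern α))
    (hsat : UnorderedTrees.PolyTimeDecidable
      (fun f : UnorderedTrees.EdgeFilter α QQ Pat => f.code cA.code cQ.code)
      (fun f => f.SingletonSatisfiable)) :
    UnorderedTrees.PolyTimeDecidable
      (fun A : UnorderedTrees.AUTC α QQ PP Pat => A.code cA.code cQ.code cP.code)
      (fun A => A.language = ∅) := by
  rw [UnorderedTrees.polyTimeDecidable_iff] at hsat ⊢
  exact (UnorderedTrees.AUTC.polyTime_finalDerivable cA cQ cP hsat).not.congr fun A => by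
    rw [A.language_eq_empty_iff]
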